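/- Let $N\ge 1$, let $B(y,1)$ denote the open unit ball of $\mathbb{R}^N$ centred at $y$, and let $L^1_{\rm ul}(\mathbb{R}^N)$ be the space of measurable functions $\phi$ on $\mathbb{R}^N$ with $\|\phi\|_{L^1_{\rm ul}}:=\sup_{y\in\mathbb{R}^N}\int_{B(y,1)}|\phi|\,dx<\infty$; let $\mathcal{L}^1_{\rm ul}(\mathbb{R}^N)$ be the closure in $L^1_{\rm ul}(\mathbb{R}^N)$ of the bounded uniformly continuous functions. For $q\in[1,\infty)$ let $S_q$ be the set of all $f\in C([0,\infty))\cap C^1((0,\infty))$ such that $f(u)>0$, $f'(u)\ge 0$ and $F(u):=\int_u^\infty \frac{d\tau}{f(\tau)}<\infty$ for all $u>0$, and $\lim_{\xi\to\infty}f'(\xi)F(\xi)=q$. We allow $F(0)=\infty$, and set $\infty^{-r}=0$ for $r>0$. For $0<\gamma<\min\{2,N\}$, $T>0$ and $u_0\ge 0$, a nonnegative measurable function $u$ on $\mathbb{R}^N\times(0,T)$ is called a local-in-time solution in $\mathbb{R}^N\times(0,T)$ of $$\partial_t u-\Delta u=|x|^{-\gamma}f(u),\qquad u(x,0)=u_0(x),$$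 if $u\in L^\infty((0,T),L^1_{\rm ul}(\mathbb{R}^N))\cap L^\infty_{\rm loc}((0,T),L^\infty(\mathbb{R}^N))$ and, for every $0<t<T$ and a.e. $x\in\mathbb{R}^N$, $$u(x,t)=[e^{t\Delta}u_0](x)+\int_0^t\big[e^{(t-s)\Delta}\,|\cdot|^{-\gamma}f(u(\cdot,s))\big](x)\,ds,$$ where $[e^{t\Delta}\phi](x)=\int_{\mathbb{R}^N}(4\pi t)^{-N/2}e^{-|x-y|^2/(4t)}\phi(y)\,dy$. **Theorem.** Let $N\ge1$, $q\in[1,\infty)$, $f\in S_q$, $r\in\mathbb{R}$, and let $u_0\ge0$ be a function on $\mathbb{R}^N$. There is a constant $C>0$, depending only on $N$, $u_0$, $f$ and $r$, such that the following holds for every $\gamma$ with $0<\gamma<\min\{2,N\}$. If one of (i) $r>\frac{N}{2-\gamma}$, $q<1+r$ and $F(u_0)^{-r}\in L^1_{\rm ul}(\mathbb{R}^N)$; (ii) $r>\frac{N}{2-\gamma}$, $q=1+r$, $F(u_0)^{-r}\in L^1_{\rm ul}(\mathbb{R}^N)$, and $f'(\xi)F(\xi)\le q$ for all sufficiently large $\xi$;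 (iii) $r=\frac{N}{2-\gamma}$, $q<1+r$ and $F(u_0)^{-r}\in\mathcal{L}^1_{\rm ul}(\mathbb{R}^N)$ holds, then there exist $T>0$ and a nonnegative local-in-time solution $u$ in $\mathbb{R}^N\times(0,T)$, and this $u$ satisfies $$\|F(u(t))^{-r}\|_{L^1_{\rm ul}(\mathbb{R}^N)}\le C\qquad\text{for all }0<t<T.$$ -/

import Mathlib

open MeasureTheory Set Filter Topology
open scoped ENNReal NNReal

namespace HardyParabolic

noncomputable section

/-- `F(u) = ∫_u^∞ dτ / f(τ)`, with values in `[0, ∞]`. It may be `∞` at `u = 0`. -/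
def tailIntegral (f : ℝ → ℝ) (u : ℝ) : ℝ≥0∞ :=
  ∫⁻ τ in Ioi u, (ENNReal.ofReal (f τ))⁻¹

/-- `F(u)^{-r}`, with the convention `∞^{-r} = 0` for `r > 0`. For `f` as in `ClassS` and
`u ≥ 0` one has `F(u) > 0`, so that the power is finite and `toReal` loses nothing. -/
def negPowF (f : ℝ → ℝ) (r : ℝ) (u : ℝ) : ℝ :=
  ((tailIntegral f u) ^ (-r)).toReal

/-- The product `f'(ξ) F(ξ)`, used for `ξ > 0` only, where `F(ξ) < ∞`. -/
def derivMulF (f : ℝ → ℝ) (ξ : ℝ) : ℝ :=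
  deriv f ξ * (tailIntegral f ξ).toReal

/-- The class `S_q` of nonlinearities on `[0, ∞)`; the values of `f` at negative arguments
play no role. -/
structure ClassS (q : ℝ) (f : ℝ → ℝ) : Prop where
  continuousOn : ContinuousOn f (Ici 0)
  contDiffOn : ContDiffOn ℝ 1 f (Ioi 0)
  pos : ∀ u, 0 < u → 0 < f u
  deriv_nonneg : ∀ u, 0 < u → 0 ≤ deriv f u
  tail_lt_top : ∀ u, 0 < u → tailIntegral f u < ∞
  tendsto : Tendsto (derivMulF f) atTop (𝓝 q)

/-- The uniformly local `L¹` norm `sup_y ∫_{B(y,1)} |φ|`, with values in `[0, ∞]`. -/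
def ulNorm {N : ℕ} (φ : EuclideanSpace ℝ (Fin N) → ℝ) : ℝ≥0∞ :=
  ⨆ y : EuclideanSpace ℝ (Fin N), ∫⁻ x in Metric.ball y 1, ‖φ x‖ₑ

/-- Membership in the uniformly local space `L¹_ul(ℝ^N)`. -/
def MemUL {N : ℕ} (φ : EuclideanSpace ℝ (Fin N) → ℝ) : Prop :=
  AEStronglyMeasurable φ volume ∧ ulNorm φ < ∞

/-- Membership in the closure of the bounded uniformly continuous functions in
`L¹_ul(ℝ^N)`. -/
def MemULClosure {N : ℕ} (φ : EuclideanSpace ℝ (Fin N) → ℝ) : Prop :=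
  MemUL φ ∧ ∀ ε : ℝ≥0∞, 0 < ε →
    ∃ g : EuclideanSpace ℝ (Fin N) → ℝ,
      UniformContinuous g ∧ (∃ M : ℝ, ∀ x, |g x| ≤ M) ∧ ulNorm (fun x => φ x - g x) < ε

/-- The heat kernel `G(z, t) = (4πt)^{-N/2} exp(-|z|² / (4t))`. -/
def heatKernel {N : ℕ} (t : ℝ) (z : EuclideanSpace ℝ (Fin N)) : ℝ :=
  (4 * Real.pi * t) ^ (-(N : ℝ) / 2) * Real.exp (-‖z‖ ^ 2 / (4 * t))

/-- `[e^{tΔ} φ](x) = ∫ G(x - y, t) φ(y) dy` for nonnegative `φ`, with values in `[0, ∞]`. -/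
def heatEvol {N : ℕ} (t : ℝ) (φ : EuclideanSpace ℝ (Fin N) → ℝ)
    (x : EuclideanSpace ℝ (Fin N)) : ℝ≥0∞ :=
  ∫⁻ y, ENNReal.ofReal (heatKernel t (x - y)) * ENNReal.ofReal (φ y)

/-- `u` (time first, then space) is a nonnegative local-in-time solution on `ℝ^N × (0, T)` of
`∂_t u - Δu = |x|^{-γ} f(u)`, `u(·, 0) = u₀`: it is a nonnegative measurable function in
`L^∞((0,T), L¹_ul) ∩ L^∞_loc((0,T), L^∞)` satisfying Duhamel's formula. As all integrands are
nonnegative, the formula is an identity in `[0, ∞]`; it says in particular that both terms on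
its right-hand side are finite. -/
structure IsLocalSolution {N : ℕ} (γ : ℝ) (f : ℝ → ℝ) (u₀ : EuclideanSpace ℝ (Fin N) → ℝ)
    (T : ℝ) (u : ℝ → EuclideanSpace ℝ (Fin N) → ℝ) : Prop where
  measurable : AEMeasurable (Function.uncurry u)
    ((volume : Measure (ℝ × EuclideanSpace ℝ (Fin N))).restrict (Ioo 0 T ×ˢ univ))
  nonneg : ∀ t ∈ Ioo 0 T, ∀ x, 0 ≤ u t x
  bounded_ul : ∃ M : ℝ≥0, ∀ᵐ t ∂(volume.restrict (Ioo 0 T)), MemUL (u t) ∧ ulNorm (u t) ≤ M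
  locally_bounded : ∀ a b : ℝ, 0 < a → b < T →
    ∃ M : ℝ≥0, ∀ᵐ t ∂(volume.restrict (Icc a b)), eLpNorm (u t) ∞ volume ≤ M
  duhamel : ∀ t ∈ Ioo 0 T, ∀ᵐ x,
    ENNReal.ofReal (u t x) = heatEvol t u₀ x +
      ∫⁻ s in Ioo 0 t, heatEvol (t - s) (fun y => ‖y‖ ^ (-γ) * f (u s y)) x

end

end HardyParabolic

/-! Put g(u) = F(u)^{-r} (`negPowF`). Since F' = -1/f, the derivative of f F^p is F^{p-1}(f'F - p),
so bounds on f'F for u ≥ ξ make suitable products f F^p monotone. In particular f'F ≤ 1 + r makes f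
F^{1+r} decreasing, hence g' = r/(f F^{1+r}) increasing and g convex on [ξ, ∞).

With h = g(ξ) + g(u₀), the barrier w = g⁻¹(2 e^{tΔ}h) is a supersolution. Write b for w(x,t) and a
for g⁻¹(e^{tΔ}h(x)). Jensen's inequality gives e^{tΔ}u₀ ≤ a (`ClassS.heatEvol_le_negPowInv`), and
convexity gives room for the nonlinear term: b - a ≥ f(b)F(b)/(2r) (`ClassS.gap_le`).

The nonlinear term must fit into this gap. `ClassS.le_of_growth` compares f(w(y,s)) with f(b)F(b),
at the cost of a power of e^{sΔ}h and a factor 1 + e^{sΔ}h(y)/e^{tΔ}h(x). The product formula for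
Gaussians gives ∫ G(x-y,t-s)|y|^{-γ} e^{sΔ}h(y) dy ≤ K (s(t-s)/t)^{-γ/2} e^{tΔ}h(x), so the quotient
disappears. With 2e^{tΔ}h ≤ E t^{-N/2}, the Duhamel integral is at most a constant times f(b)F(b)
E^{1/r} t^κ, where κ = 1 - γ/2 - N/(2r) (`ClassS.lintegral_barrier_le`).

If r > N/(2-γ), then κ > 0 and a short time suffices. If r = N/(2-γ), then κ = 0, but approximation
by bounded functions makes E small; the strict inequality q < 1 + r leaves a margin δ > 0 that keeps
the time integral convergent. Monotone iteration below w then produces u, and g(u) ≤ 2e^{tΔ}h gives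
the final bound. -/

namespace HardyParabolic

/-! ### Monotonicity and convexity properties of f, F and F^{-r}. -/

section Nonlinearity

variable {q r : ℝ} {f : ℝ → ℝ}

lemma negPowF_eq (f : ℝ → ℝ) (r u : ℝ) : negPowF f r u = (tailIntegral f u).toReal ^ (-r) :=
  (ENNReal.toReal_rpow _ _).symm

lemma negPowF_nonneg (f : ℝ → ℝ) (r u : ℝ) : 0 ≤ negPowF f r u := ENNReal.toReal_nonneg

lemma tailIntegral_antitone (f : ℝ → ℝ) : Antitone (tailIntegral f) := fun _ _ h =>
  lintegral_mono_set (Ioi_subset_Ioi h)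

lemma measurable_negPowF (f : ℝ → ℝ) (r : ℝ) : Measurable (negPowF f r) :=
  ((tailIntegral_antitone f).measurable.pow_const _).ennreal_toReal

lemma ClassS.monotoneOn (hf : ClassS q f) : MonotoneOn f (Ici 0) := by
  refine monotoneOn_of_deriv_nonneg (convex_Ici 0) hf.continuousOn ?_ ?_
  · rw [interior_Ici]; exact hf.contDiffOn.differentiableOn (by norm_num)
  · rw [interior_Ici]; exact fun u hu => hf.deriv_nonneg u hu

lemma ClassS.nonneg (hf : ClassS q f) {u : ℝ} (hu : 0 ≤ u) : 0 ≤ f u := by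
  rcases hu.eq_or_lt with rfl | hu
  · have h1 : Tendsto f (𝓝[>] 0) (𝓝 (f 0)) :=
      (hf.continuousOn 0 self_mem_Ici).mono_left (nhdsWithin_mono _ Ioi_subset_Ici_self)
    exact ge_of_tendsto h1 (eventually_mem_nhdsWithin.mono fun u hu => (hf.pos u hu).le)
  · exact (hf.pos u hu).le

lemma ClassS.hasDerivAt (hf : ClassS q f) {u : ℝ} (hu : 0 < u) :
    HasDerivAt f (deriv f u) u :=
  ((hf.contDiffOn.differentiableOn (by norm_num)).differentiableAt (Ioi_mem_nhds hu)).hasDerivAt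

lemma ClassS.tail_strictAnti (hf : ClassS q f) {u v : ℝ} (hu : 0 ≤ u) (huv : u < v) :
    tailIntegral f v < tailIntegral f u := by
  have hv : 0 < v := lt_of_le_of_lt hu huv
  have h1 : tailIntegral f u = (∫⁻ τ in Ioc u v, (ENNReal.ofReal (f τ))⁻¹) + tailIntegral f v := by
    rw [tailIntegral, ← Ioc_union_Ioi_eq_Ioi huv.le,
      lintegral_union measurableSet_Ioi (Ioc_disjoint_Ioi le_rfl)]
    rfl
  have h2 : (ENNReal.ofReal (f v))⁻¹ * ENNReal.ofReal (v - u) ≤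
      ∫⁻ τ in Ioc u v, (ENNReal.ofReal (f τ))⁻¹ := by
    rw [← Real.volume_Ioc, ← setLIntegral_const]
    refine setLIntegral_mono' measurableSet_Ioc fun τ hτ => ?_
    exact ENNReal.inv_le_inv.2 (ENNReal.ofReal_le_ofReal
      (hf.monotoneOn (hu.trans hτ.1.le) hv.le hτ.2))
  have h3 : 0 < (ENNReal.ofReal (f v))⁻¹ * ENNReal.ofReal (v - u) :=
    ENNReal.mul_pos (ENNReal.inv_ne_zero.2 ENNReal.ofReal_ne_top)
      (ENNReal.ofReal_pos.2 (sub_pos.2 huv)).ne'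
  rw [h1, add_comm]
  exact ENNReal.lt_add_right (hf.tail_lt_top v hv).ne (h3.trans_le h2).ne'

lemma ClassS.tail_pos (hf : ClassS q f) {u : ℝ} (hu : 0 ≤ u) : 0 < tailIntegral f u :=
  bot_le.trans_lt (hf.tail_strictAnti hu (lt_add_one u))

/-- The finite value of the tail integral. -/
noncomputable def tailReal (f : ℝ → ℝ) (u : ℝ) : ℝ := (tailIntegral f u).toReal

lemma ClassS.tailReal_pos (hf : ClassS q f) {u : ℝ} (hu : 0 < u) : 0 < tailReal f u :=
  ENNReal.toReal_pos (hf.tail_pos hu.le).ne' (hf.tail_lt_top u hu).ne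

lemma ClassS.continuousOn_inv (hf : ClassS q f) : ContinuousOn (fun u => (f u)⁻¹) (Ioi 0) :=
  (hf.continuousOn.mono Ioi_subset_Ici_self).inv₀ fun u hu => (hf.pos u hu).ne'

lemma ClassS.integrableOn_inv (hf : ClassS q f) {u : ℝ} (hu : 0 < u) :
    IntegrableOn (fun u => (f u)⁻¹) (Ioi u) := by
  refine ⟨(hf.continuousOn_inv.mono (Ioi_subset_Ioi hu.le)).aestronglyMeasurable
    measurableSet_Ioi, ?_⟩
  refine lt_of_eq_of_lt (setLIntegral_congr_fun measurableSet_Ioi fun τ hτ => ?_)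
    (hf.tail_lt_top u hu)
  have := hf.pos τ (hu.trans hτ)
  rw [Real.enorm_of_nonneg (by positivity), ENNReal.ofReal_inv_of_pos this]

lemma ClassS.tailReal_eq (hf : ClassS q f) {u : ℝ} (hu : 0 < u) :
    tailReal f u = ∫ τ in Ioi u, (f τ)⁻¹ := by
  rw [integral_eq_lintegral_of_nonneg_ae, tailReal, tailIntegral]
  · congr 1
    refine setLIntegral_congr_fun measurableSet_Ioi fun τ hτ => ?_
    rw [ENNReal.ofReal_inv_of_pos (hf.pos τ (hu.trans hτ))]
  · refine (ae_restrict_iff' measurableSet_Ioi).2 (ae_of_all _ fun τ hτ => ?_)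
    exact inv_nonneg.2 (hf.pos τ (hu.trans hτ)).le
  · exact (hf.integrableOn_inv hu).1

lemma ClassS.hasDerivAt_tailReal (hf : ClassS q f) {u : ℝ} (hu : 0 < u) :
    HasDerivAt (tailReal f) (-(f u)⁻¹) u := by
  have h2 : 0 < u / 2 := by positivity
  have h1 : HasDerivAt (fun v => (∫ τ in Ioi (u / 2), (f τ)⁻¹) - ∫ τ in (u / 2)..v, (f τ)⁻¹)
      (-(f u)⁻¹) u := by
    refine (intervalIntegral.integral_hasDerivAt_right ?_ ?_ ?_).const_sub _
    · refine ContinuousOn.intervalIntegrable (hf.continuousOn_inv.mono ?_)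
      rw [uIcc_of_le (by linarith)]
      exact fun x hx => h2.trans_le hx.1
    · exact hf.continuousOn_inv.stronglyMeasurableAtFilter isOpen_Ioi _ hu
    · exact hf.continuousOn_inv.continuousAt (Ioi_mem_nhds hu)
  refine h1.congr_of_eventuallyEq ?_
  filter_upwards [Ioi_mem_nhds (show u / 2 < u by linarith)] with v hv
  have hv' : u / 2 < v := hv
  rw [hf.tailReal_eq (h2.trans hv'), intervalIntegral.integral_of_le hv'.le, eq_sub_iff_add_eq',
    ← setIntegral_union (by simp) measurableSet_Ioi
      ((hf.integrableOn_inv h2).mono_set Ioc_subset_Ioi_self) (hf.integrableOn_inv (h2.trans hv')),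
    Ioc_union_Ioi_eq_Ioi hv'.le]

lemma ClassS.tendsto_tailReal (hf : ClassS q f) : Tendsto (tailReal f) atTop (𝓝 0) := by
  refine (tendsto_integral_Ioi_zero (f := fun τ => (f τ)⁻¹) (μ := volume) tendsto_id).congr' ?_
  filter_upwards [eventually_gt_atTop 0] with u hu
  rw [hf.tailReal_eq hu]; rfl

/-- Only the sign of f'F - p matters: this is how the limit of f'F enters every growth estimate. -/
lemma ClassS.hasDerivAt_mul_rpow (hf : ClassS q f) {u : ℝ} (hu : 0 < u) (p : ℝ) :
    HasDerivAt (fun v => f v * tailReal f v ^ p)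
      (tailReal f u ^ (p - 1) * (derivMulF f u - p)) u := by
  have hF := hf.tailReal_pos hu
  have hfu := hf.pos u hu
  convert! (hf.hasDerivAt hu).fun_mul ((hf.hasDerivAt_tailReal hu).rpow_const (p := p) (Or.inl hF.ne'))
    using 1
  have : tailReal f u ^ p = tailReal f u ^ (p - 1) * tailReal f u := by
    rw [← Real.rpow_add_one hF.ne']; ring_nf
  rw [this, derivMulF]
  change _ * (deriv f u * tailReal f u - p) = _
  field_simp
  ring

lemma ClassS.monotoneOn_mul_rpow (hf : ClassS q f) {ξ p : ℝ} (hξ : 0 < ξ)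
    (h : ∀ u, ξ ≤ u → p ≤ derivMulF f u) :
    MonotoneOn (fun v => f v * tailReal f v ^ p) (Ici ξ) := by
  have hd : ∀ u ∈ Ici ξ, _ := fun u hu => hf.hasDerivAt_mul_rpow (hξ.trans_le hu) p
  refine monotoneOn_of_deriv_nonneg (convex_Ici ξ)
    (fun u hu => (hd u hu).continuousAt.continuousWithinAt)
    (fun u hu => (hd u (interior_subset hu)).differentiableAt.differentiableWithinAt) ?_
  intro u hu
  have hu' := interior_subset hu
  rw [(hd u hu').deriv]
  exact mul_nonneg (Real.rpow_nonneg (hf.tailReal_pos (hξ.trans_le hu')).le _)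
    (sub_nonneg.2 (h u hu'))

lemma ClassS.antitoneOn_mul_rpow (hf : ClassS q f) {ξ p : ℝ} (hξ : 0 < ξ)
    (h : ∀ u, ξ ≤ u → derivMulF f u ≤ p) :
    AntitoneOn (fun v => f v * tailReal f v ^ p) (Ici ξ) := by
  have hd : ∀ u ∈ Ici ξ, _ := fun u hu => hf.hasDerivAt_mul_rpow (hξ.trans_le hu) p
  refine antitoneOn_of_deriv_nonpos (convex_Ici ξ)
    (fun u hu => (hd u hu).continuousAt.continuousWithinAt)
    (fun u hu => (hd u (interior_subset hu)).differentiableAt.differentiableWithinAt) ?_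
  intro u hu
  have hu' := interior_subset hu
  rw [(hd u hu').deriv]
  exact mul_nonpos_of_nonneg_of_nonpos
    (Real.rpow_nonneg (hf.tailReal_pos (hξ.trans_le hu')).le _) (sub_nonpos.2 (h u hu'))

lemma ClassS.hasDerivAt_negPowF (hf : ClassS q f) {u : ℝ} (hu : 0 < u) :
    HasDerivAt (negPowF f r) (r * (f u * tailReal f u ^ (1 + r))⁻¹) u := by
  have hF := hf.tailReal_pos hu
  have hfu := hf.pos u hu
  have h := (hf.hasDerivAt_tailReal hu).rpow_const (p := -r) (Or.inl hF.ne')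
  have he : (fun v => tailReal f v ^ (-r)) = negPowF f r := funext fun v => (negPowF_eq f r v).symm
  rw [he] at h
  convert h using 1
  rw [show -r - 1 = -(1 + r) by ring, Real.rpow_neg hF.le]
  field_simp

lemma ClassS.negPowF_strictMonoOn (hf : ClassS q f) (hr : 0 < r) :
    StrictMonoOn (negPowF f r) (Ici 0) := by
  intro u hu v _ huv
  have hv : 0 < v := lt_of_le_of_lt hu huv
  have hFv := hf.tailReal_pos hv
  have h := hf.tail_strictAnti hu huv
  rw [negPowF_eq, negPowF_eq]
  change _ < tailReal f v ^ (-r)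
  by_cases htop : tailIntegral f u = ∞
  · rw [htop, ENNReal.toReal_top, Real.zero_rpow (by linarith)]
    positivity
  · exact Real.rpow_lt_rpow_of_neg hFv (ENNReal.toReal_strict_mono htop h) (by linarith)

lemma ClassS.negPowF_pos (hf : ClassS q f) {u : ℝ} (hu : 0 < u) : 0 < negPowF f r u := by
  rw [negPowF_eq]; exact Real.rpow_pos_of_pos (hf.tailReal_pos hu) _

lemma ClassS.tendsto_negPowF (hf : ClassS q f) (hr : 0 < r) :
    Tendsto (negPowF f r) atTop atTop := by
  have h1 : Tendsto (tailReal f) atTop (𝓝[>] 0) :=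
    tendsto_nhdsWithin_iff.2 ⟨hf.tendsto_tailReal,
      (eventually_gt_atTop 0).mono fun u hu => hf.tailReal_pos hu⟩
  refine ((tendsto_rpow_neg_nhdsGT_zero (by linarith : -r < 0)).comp h1).congr fun u => ?_
  rw [negPowF_eq]; rfl

/-- A generalised inverse of `negPowF f r` on the half-line. -/
noncomputable def negPowInv (f : ℝ → ℝ) (r v : ℝ) : ℝ := sSup {u | 0 ≤ u ∧ negPowF f r u ≤ v}

lemma ClassS.bddAbove_sublevel (hf : ClassS q f) (hr : 0 < r) (v : ℝ) :
    BddAbove {u | 0 ≤ u ∧ negPowF f r u ≤ v} := by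
  obtain ⟨a, ha⟩ := ((hf.tendsto_negPowF hr).eventually_gt_atTop v).exists_forall_of_atTop
  refine ⟨a, fun u hu => ?_⟩
  by_contra! h
  exact absurd (ha u h.le) (not_lt.2 hu.2)

lemma ClassS.negPowInv_negPowF (hf : ClassS q f) (hr : 0 < r) {u : ℝ} (hu : 0 ≤ u) :
    negPowInv f r (negPowF f r u) = u := by
  have : {w | 0 ≤ w ∧ negPowF f r w ≤ negPowF f r u} = Icc 0 u := by
    ext w
    constructor
    · exact fun h => ⟨h.1, ((hf.negPowF_strictMonoOn hr).le_iff_le h.1 hu).1 h.2⟩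
    · exact fun h => ⟨h.1, ((hf.negPowF_strictMonoOn hr).le_iff_le h.1 hu).2 h.2⟩
  rw [negPowInv, this, csSup_Icc hu]

lemma negPowInv_nonneg (f : ℝ → ℝ) (r v : ℝ) : 0 ≤ negPowInv f r v :=
  Real.sSup_nonneg fun _ h => h.1

/-- Monotonicity on all of ℝ makes the inverse Borel, which later recovers measurability of `u₀`
from that of F(u₀)^{-r}. -/
lemma ClassS.negPowInv_monotone (hf : ClassS q f) (hr : 0 < r) : Monotone (negPowInv f r) := by
  intro a b hab
  -- Below g(0) the sublevel set is empty, and `sSup ∅ = 0` is the right value for monotonicity.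
  rcases Set.eq_empty_or_nonempty {u | 0 ≤ u ∧ negPowF f r u ≤ a} with h | h
  · rw [negPowInv, h, Real.sSup_empty]; exact negPowInv_nonneg f r b
  · exact csSup_le_csSup (hf.bddAbove_sublevel hr b) h fun u hu => ⟨hu.1, hu.2.trans hab⟩

lemma ClassS.exists_negPowF_eq (hf : ClassS q f) (hr : 0 < r) {ξ v : ℝ} (hξ : 0 < ξ)
    (hv : negPowF f r ξ ≤ v) : ∃ u, ξ ≤ u ∧ negPowF f r u = v := by
  obtain ⟨a, ha1, ha2⟩ :=
    (((hf.tendsto_negPowF hr).eventually_ge_atTop v).and (eventually_ge_atTop ξ)).exists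
  have hc : ContinuousOn (negPowF f r) (Icc ξ a) := fun u hu =>
    (hf.hasDerivAt_negPowF (hξ.trans_le hu.1)).continuousAt.continuousWithinAt
  obtain ⟨u, hu, hu'⟩ := intermediate_value_Icc ha2 hc ⟨hv, ha1⟩
  exact ⟨u, hu.1, hu'⟩

lemma ClassS.negPowF_negPowInv (hf : ClassS q f) (hr : 0 < r) {ξ v : ℝ} (hξ : 0 < ξ)
    (hv : negPowF f r ξ ≤ v) : negPowF f r (negPowInv f r v) = v := by
  obtain ⟨u, hu, rfl⟩ := hf.exists_negPowF_eq hr hξ hv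
  rw [hf.negPowInv_negPowF hr (hξ.le.trans hu)]

lemma ClassS.le_negPowInv (hf : ClassS q f) (hr : 0 < r) {ξ v : ℝ} (hξ : 0 < ξ)
    (hv : negPowF f r ξ ≤ v) : ξ ≤ negPowInv f r v := by
  obtain ⟨u, hu, rfl⟩ := hf.exists_negPowF_eq hr hξ hv
  rwa [hf.negPowInv_negPowF hr (hξ.le.trans hu)]

/-- Convexity of g on [ξ, ∞) as a tangent-line inequality: f F^{1+r} decreases there, so g'
increases. -/
lemma ClassS.negPowF_tangent (hf : ClassS q f) (hr : 0 < r) {ξ : ℝ} (hξ : 0 < ξ)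
    (h : ∀ u, ξ ≤ u → derivMulF f u ≤ 1 + r) {a b : ℝ} (ha : ξ ≤ a) (hb : ξ ≤ b) :
    negPowF f r a + r * (f a * tailReal f a ^ (1 + r))⁻¹ * (b - a) ≤ negPowF f r b := by
  have hanti := hf.antitoneOn_mul_rpow hξ h
  have hpos : ∀ u, ξ ≤ u → 0 < f u * tailReal f u ^ (1 + r) := fun u hu =>
    mul_pos (hf.pos u (hξ.trans_le hu)) (Real.rpow_pos_of_pos (hf.tailReal_pos (hξ.trans_le hu)) _)
  have hd : ∀ u, ξ ≤ u → HasDerivAt (negPowF f r) (r * (f u * tailReal f u ^ (1 + r))⁻¹) u :=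
    fun u hu => hf.hasDerivAt_negPowF (hξ.trans_le hu)
  have hmono : ∀ u v, ξ ≤ u → u ≤ v → r * (f u * tailReal f u ^ (1 + r))⁻¹ ≤
      r * (f v * tailReal f v ^ (1 + r))⁻¹ := fun u v hu huv =>
    mul_le_mul_of_nonneg_left
      (inv_anti₀ (hpos v (hu.trans huv)) (hanti hu (hu.trans huv) huv)) hr.le
  rcases lt_trichotomy a b with hab | rfl | hab
  · obtain ⟨c, hc, hc'⟩ := exists_hasDerivAt_eq_slope (negPowF f r) _ hab
      (fun u hu => (hd u (ha.trans hu.1)).continuousAt.continuousWithinAt)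
      (fun u hu => hd u (ha.trans hu.1.le))
    have := hmono a c ha hc.1.le
    rw [hc', le_div_iff₀ (by linarith)] at this
    linarith
  · simp
  · obtain ⟨c, hc, hc'⟩ := exists_hasDerivAt_eq_slope (negPowF f r) _ hab
      (fun u hu => (hd u (hb.trans hu.1)).continuousAt.continuousWithinAt)
      (fun u hu => hd u (hb.trans hu.1.le))
    have := hmono c a (hb.trans hc.1.le) hc.2.le
    rw [hc', div_le_iff₀ (by linarith)] at this
    linarith

end Nonlinearity

/-! ### Heat kernel estimates in uniformly local spaces and with the weight |x|^{-γ}. -/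

section Heat

variable {N : ℕ}

lemma heatKernel_nonneg {t : ℝ} (ht : 0 < t) (z : EuclideanSpace ℝ (Fin N)) :
    0 ≤ heatKernel t z := by
  unfold heatKernel; positivity

lemma measurable_heatKernel :
    Measurable (fun p : ℝ × EuclideanSpace ℝ (Fin N) => heatKernel p.1 p.2) := by
  unfold heatKernel
  fun_prop

lemma measurable_heatKernel_const (t : ℝ) :
    Measurable (heatKernel t : EuclideanSpace ℝ (Fin N) → ℝ) :=
  measurable_heatKernel.comp measurable_prodMk_left

lemma integral_gaussian_pos {b : ℝ} (hb : 0 < b) :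
    0 < ∫ v : EuclideanSpace ℝ (Fin N), Real.exp (-b * ‖v‖ ^ 2) := by
  rw [GaussianFourier.integral_rexp_neg_mul_sq_norm hb]
  positivity

lemma integrable_gaussian {b : ℝ} (hb : 0 < b) :
    Integrable fun v : EuclideanSpace ℝ (Fin N) => Real.exp (-b * ‖v‖ ^ 2) := by
  by_contra h
  exact (integral_gaussian_pos (N := N) hb).ne' (integral_undef h)

lemma lintegral_heatKernel {t : ℝ} (ht : 0 < t) :
    ∫⁻ z : EuclideanSpace ℝ (Fin N), ENNReal.ofReal (heatKernel t z) = 1 := by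
  have hb : 0 < 1 / (4 * t) := by positivity
  have he : ∀ z : EuclideanSpace ℝ (Fin N), heatKernel t z =
      (4 * Real.pi * t) ^ (-(N : ℝ) / 2) * Real.exp (-(1 / (4 * t)) * ‖z‖ ^ 2) := by
    intro z
    rw [heatKernel]
    congr 2
    ring
  simp_rw [he]
  rw [← ofReal_integral_eq_lintegral_ofReal ((integrable_gaussian hb).const_mul _)
    (ae_of_all _ fun z => by positivity), integral_const_mul,
    GaussianFourier.integral_rexp_neg_mul_sq_norm hb]
  rw [show Real.pi / (1 / (4 * t)) = 4 * Real.pi * t by field_simp, finrank_euclideanSpace,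
    Fintype.card_fin, ← Real.rpow_add (by positivity), neg_div, neg_add_cancel]
  simp

lemma lintegral_heatKernel_sub {t : ℝ} (ht : 0 < t) (x : EuclideanSpace ℝ (Fin N)) :
    ∫⁻ y, ENNReal.ofReal (heatKernel t (x - y)) = 1 := by
  rw [lintegral_sub_left_eq_self (fun z => ENNReal.ofReal (heatKernel t z)) x]
  exact lintegral_heatKernel ht

lemma measurable_heatKernel_sub (t : ℝ) (x : EuclideanSpace ℝ (Fin N)) :
    Measurable fun y => ENNReal.ofReal (heatKernel t (x - y)) :=
  ((measurable_heatKernel_const t).comp (measurable_const.sub measurable_id)).ennreal_ofReal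

lemma heatEvol_mono {t : ℝ} {φ ψ : EuclideanSpace ℝ (Fin N) → ℝ} (h : ∀ x, φ x ≤ ψ x)
    (x : EuclideanSpace ℝ (Fin N)) : heatEvol t φ x ≤ heatEvol t ψ x :=
  lintegral_mono fun y => mul_le_mul_right (ENNReal.ofReal_le_ofReal (h y)) _

lemma heatEvol_const {t : ℝ} (ht : 0 < t) (c : ℝ) (x : EuclideanSpace ℝ (Fin N)) :
    heatEvol t (fun _ => c) x = ENNReal.ofReal c := by
  rw [heatEvol, lintegral_mul_const _ (measurable_heatKernel_sub t x),
    lintegral_heatKernel_sub ht, one_mul]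

lemma heatEvol_const_add {t : ℝ} (ht : 0 < t) {c : ℝ} (hc : 0 ≤ c)
    {φ : EuclideanSpace ℝ (Fin N) → ℝ} (hφ : ∀ x, 0 ≤ φ x) (x : EuclideanSpace ℝ (Fin N)) :
    heatEvol t (fun y => c + φ y) x = ENNReal.ofReal c + heatEvol t φ x := by
  simp_rw [heatEvol, ENNReal.ofReal_add hc (hφ _), mul_add]
  rw [lintegral_add_left ((measurable_heatKernel_sub t x).mul_const _)]
  congr 1
  exact heatEvol_const ht c x

/-- For t ≤ 1 the kernel at x - y is at most t^{-N/2} times the average over w in B(y,1) of a fixed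
Gaussian in x - w. Exchanging the integrals leaves integrals of φ over unit balls B(w,1), weighted
by an integrable Gaussian. -/
lemma exists_heatEvol_le_ulNorm (N : ℕ) : ∃ C : ℝ, 0 ≤ C ∧
    ∀ φ : EuclideanSpace ℝ (Fin N) → ℝ, Measurable φ → ∀ t : ℝ, 0 < t → t ≤ 1 →
      ∀ x, heatEvol t φ x ≤ ENNReal.ofReal (C * t ^ (-(N : ℝ) / 2)) * ulNorm φ := by
  set J := ∫ v : EuclideanSpace ℝ (Fin N), Real.exp (-(1 / 8) * ‖v‖ ^ 2) with hJ
  have hJ0 : 0 ≤ J := (integral_gaussian_pos (by norm_num)).le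
  have hJ' : ∀ x : EuclideanSpace ℝ (Fin N),
      ∫⁻ w, ENNReal.ofReal (Real.exp (-(1 / 8) * ‖x - w‖ ^ 2)) = ENNReal.ofReal J := by
    intro x
    rw [lintegral_sub_left_eq_self
      (fun z : EuclideanSpace ℝ (Fin N) => ENNReal.ofReal (Real.exp (-(1 / 8) * ‖z‖ ^ 2))) x,
      ← ofReal_integral_eq_lintegral_ofReal (integrable_gaussian (by norm_num))
      (ae_of_all _ fun z => by positivity)]
  set V := volume (Metric.ball (0 : EuclideanSpace ℝ (Fin N)) 1) with hV
  have hV0 : 0 < V := Metric.measure_ball_pos _ _ one_pos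
  have hVt : V < ∞ := measure_ball_lt_top
  have hVr : 0 < V.toReal := ENNReal.toReal_pos hV0.ne' hVt.ne
  refine ⟨Real.exp (1 / 4) * J / V.toReal, by positivity, fun φ hφ t ht ht1 x => ?_⟩
  have hker : ∀ y, ENNReal.ofReal (heatKernel t (x - y)) * V ≤
      ENNReal.ofReal (Real.exp (1 / 4) * t ^ (-(N : ℝ) / 2)) *
        ∫⁻ w in Metric.ball y 1, ENNReal.ofReal (Real.exp (-(1 / 8) * ‖x - w‖ ^ 2)) := by
    intro y
    have hy : V = volume (Metric.ball y 1) := by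
      rw [hV, Measure.addHaar_ball_center volume y]
    rw [hy, ← setLIntegral_const, ← lintegral_const_mul' _ _ ENNReal.ofReal_ne_top]
    refine setLIntegral_mono' measurableSet_ball fun w hw => ?_
    rw [← ENNReal.ofReal_mul (by positivity)]
    refine ENNReal.ofReal_le_ofReal ?_
    rw [heatKernel, mul_comm (Real.exp (1 / 4)), mul_assoc (t ^ (-(N : ℝ) / 2)), ← Real.exp_add,
      Real.mul_rpow (by positivity) ht.le, mul_assoc ((4 * Real.pi) ^ (-(N : ℝ) / 2))]
    have hpi : (4 * Real.pi) ^ (-(N : ℝ) / 2) ≤ 1 := by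
      refine Real.rpow_le_one_of_one_le_of_nonpos ?_ ?_
      · nlinarith [Real.pi_gt_three]
      · have : (0 : ℝ) ≤ N := N.cast_nonneg
        linarith
    refine (mul_le_of_le_one_left (by positivity) hpi).trans ?_
    refine mul_le_mul_of_nonneg_left (Real.exp_le_exp.2 ?_) (by positivity)
    have h1 : ‖x - w‖ ≤ ‖x - y‖ + 1 := by
      calc ‖x - w‖ = ‖(x - y) + (y - w)‖ := by congr 1; abel
        _ ≤ ‖x - y‖ + ‖y - w‖ := norm_add_le _ _
        _ ≤ _ := by
          rw [Metric.mem_ball, dist_comm, dist_eq_norm] at hw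
          linarith
    -- The factor e^{1/4} comes from (d+1)²/8 ≤ d²/4 + 1/4, equivalent to (d-1)² ≥ 0.
    have h2 : ‖x - w‖ ^ 2 ≤ (‖x - y‖ + 1) ^ 2 := by gcongr
    have h3 : ‖x - y‖ ^ 2 / 4 ≤ ‖x - y‖ ^ 2 / (4 * t) :=
      div_le_div_of_nonneg_left (by positivity) (by positivity) (by linarith)
    rw [neg_div]
    nlinarith [sq_nonneg (‖x - y‖ - 1)]
  have hmain : heatEvol t φ x * V ≤
      ENNReal.ofReal (Real.exp (1 / 4) * t ^ (-(N : ℝ) / 2)) * (ENNReal.ofReal J * ulNorm φ) := by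
    rw [heatEvol, ← lintegral_mul_const' _ _ hVt.ne]
    calc ∫⁻ y, ENNReal.ofReal (heatKernel t (x - y)) * ENNReal.ofReal (φ y) * V
        ≤ ∫⁻ y, ENNReal.ofReal (Real.exp (1 / 4) * t ^ (-(N : ℝ) / 2)) *
            ∫⁻ w, (if dist w y < 1 then 1 else 0) *
              (ENNReal.ofReal (Real.exp (-(1 / 8) * ‖x - w‖ ^ 2)) * ENNReal.ofReal (φ y)) := by
          refine lintegral_mono fun y => ?_
          rw [mul_right_comm]
          refine (mul_le_mul_left (hker y) _).trans (le_of_eq ?_)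
          rw [mul_assoc, ← lintegral_mul_const' _ _ ENNReal.ofReal_ne_top,
            ← lintegral_indicator measurableSet_ball]
          congr 2
          ext w
          by_cases hw : dist w y < 1 <;> simp [indicator, hw]
      _ = ENNReal.ofReal (Real.exp (1 / 4) * t ^ (-(N : ℝ) / 2)) *
            ∫⁻ w, ENNReal.ofReal (Real.exp (-(1 / 8) * ‖x - w‖ ^ 2)) *
              ∫⁻ y in Metric.ball w 1, ENNReal.ofReal (φ y) := by
          rw [lintegral_const_mul' _ _ ENNReal.ofReal_ne_top, lintegral_lintegral_swap]
          · congr 2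
            ext w
            rw [← lintegral_indicator measurableSet_ball,
              ← lintegral_const_mul' _ _ ENNReal.ofReal_ne_top]
            congr 1
            ext y
            by_cases hw : dist w y < 1
            · simp [indicator, hw, dist_comm y w]
            · simp [indicator, hw, dist_comm y w]
          · refine Measurable.aemeasurable ?_
            refine Measurable.mul (Measurable.ite ?_ measurable_const measurable_const) ?_
            · exact measurableSet_lt (by fun_prop) measurable_const
            · fun_prop
      _ ≤ ENNReal.ofReal (Real.exp (1 / 4) * t ^ (-(N : ℝ) / 2)) *
            ∫⁻ w, ENNReal.ofReal (Real.exp (-(1 / 8) * ‖x - w‖ ^ 2)) * ulNorm φ := by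
          gcongr with w
          refine le_trans (lintegral_mono fun y => ?_)
            (le_iSup (fun z => ∫⁻ y in Metric.ball z 1, ‖φ y‖ₑ) w)
          exact Real.ofReal_le_enorm _
      _ = _ := by rw [lintegral_mul_const _ (by fun_prop), hJ']
  have hV2 : V = ENNReal.ofReal V.toReal := (ENNReal.ofReal_toReal hVt.ne).symm
  refine (ENNReal.le_div_iff_mul_le (Or.inl hV0.ne') (Or.inl hVt.ne)).2 hmain |>.trans
    (le_of_eq ?_)
  rw [div_eq_mul_inv, ← mul_assoc, mul_right_comm]
  congr 1
  rw [hV2, ← ENNReal.ofReal_inv_of_pos hVr, ENNReal.toReal_ofReal hVr.le,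
    ← ENNReal.ofReal_mul (by positivity), ← ENNReal.ofReal_mul (by positivity)]
  congr 1
  ring

/-- The evolution is an average of translates of φ, and translating only moves the ball of
integration. -/
lemma ulNorm_heatEvol_le {t : ℝ} (ht : 0 < t) {φ : EuclideanSpace ℝ (Fin N) → ℝ}
    (hφ : Measurable φ) (x₀ : EuclideanSpace ℝ (Fin N)) :
    ∫⁻ x in Metric.ball x₀ 1, heatEvol t φ x ≤ ulNorm φ := by
  have h1 : ∀ x, heatEvol t φ x =
      ∫⁻ z, ENNReal.ofReal (heatKernel t z) * ENNReal.ofReal (φ (x - z)) := by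
    intro x
    rw [heatEvol, ← lintegral_sub_left_eq_self _ x]
    simp
  simp_rw [h1]
  rw [lintegral_lintegral_swap]
  · calc _ ≤ ∫⁻ z : EuclideanSpace ℝ (Fin N), ENNReal.ofReal (heatKernel t z) * ulNorm φ := by
          refine lintegral_mono fun z => ?_
          rw [lintegral_const_mul' _ _ ENNReal.ofReal_ne_top]
          gcongr
          calc ∫⁻ x in Metric.ball x₀ 1, ENNReal.ofReal (φ (x - z))
              ≤ ∫⁻ x in Metric.ball x₀ 1, ‖φ (x - z)‖ₑ :=
                lintegral_mono fun x => Real.ofReal_le_enorm _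
            _ = ∫⁻ x in Metric.ball (x₀ - z) 1, ‖φ x‖ₑ := by
                rw [← lintegral_indicator measurableSet_ball,
                  ← lintegral_indicator measurableSet_ball,
                  ← lintegral_sub_right_eq_self
                    ((Metric.ball (x₀ - z) 1).indicator fun x => ‖φ x‖ₑ) z]
                congr 1
                ext x
                simp only [indicator, Metric.mem_ball, dist_sub_right]
            _ ≤ _ := le_iSup (fun z => ∫⁻ y in Metric.ball z 1, ‖φ y‖ₑ) _
      _ = ulNorm φ := by
          rw [lintegral_mul_const _ (measurable_heatKernel_const t).ennreal_ofReal,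
            lintegral_heatKernel ht, one_mul]
  · refine Measurable.aemeasurable ?_
    change Measurable fun p : EuclideanSpace ℝ (Fin N) × EuclideanSpace ℝ (Fin N) =>
      ENNReal.ofReal (heatKernel t p.2) * ENNReal.ofReal (φ (p.1 - p.2))
    refine Measurable.fun_mul ?_ ?_
    · exact ((measurable_heatKernel_const t).comp measurable_snd).ennreal_ofReal
    · fun_prop

lemma setLIntegral_norm_rpow_lt_top (hN : 1 ≤ N) {γ : ℝ} (hγ : γ < N) :
    ∫⁻ y in Metric.ball (0 : EuclideanSpace ℝ (Fin N)) 1, ENNReal.ofReal (‖y‖ ^ (-γ)) < ∞ := by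
  have : Nonempty (Fin N) := ⟨⟨0, hN⟩⟩
  have h : IntegrableOn (fun y : EuclideanSpace ℝ (Fin N) => ‖y‖ ^ (-γ)) (Metric.ball 0 1) := by
    rw [integrableOn_fun_norm_addHaar volume (f := fun ρ => ρ ^ (-γ))]
    rw [finrank_euclideanSpace, Fintype.card_fin]
    have h2 : IntegrableOn (fun ρ : ℝ => ρ ^ ((N : ℝ) - 1 - γ)) (Ioo 0 1) := by
      refine (intervalIntegral.integrableOn_Ioo_rpow_iff one_pos).2 ?_
      linarith
    refine h2.congr_fun (fun ρ hρ => ?_) measurableSet_Ioo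
    have : ρ ^ (N - 1) = ρ ^ ((N : ℝ) - 1) := by
      rw [← Real.rpow_natCast, Nat.cast_sub hN, Nat.cast_one]
    rw [smul_eq_mul, this, ← Real.rpow_add hρ.1]
    ring_nf
  refine lt_of_le_of_lt (lintegral_mono fun y => ?_) h.2
  exact Real.ofReal_le_enorm _

/-- At time 1, the weight is integrable on the unit ball because γ < N and is at most 1 outside it.
Homogeneity under y ↦ √τ y gives all other times. -/
lemma exists_heatEvol_norm_rpow_le (hN : 1 ≤ N) {γ : ℝ} (hγ0 : 0 < γ) (hγ : γ < N) :
    ∃ K : ℝ, 0 < K ∧ ∀ τ : ℝ, 0 < τ → ∀ x : EuclideanSpace ℝ (Fin N),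
      heatEvol τ (fun y => ‖y‖ ^ (-γ)) x ≤ ENNReal.ofReal (K * τ ^ (-γ / 2)) := by
  set I := ∫⁻ y in Metric.ball (0 : EuclideanSpace ℝ (Fin N)) 1, ENNReal.ofReal (‖y‖ ^ (-γ))
    with hI
  have hIt : I < ∞ := setLIntegral_norm_rpow_lt_top hN hγ
  have hone : ∀ x : EuclideanSpace ℝ (Fin N),
      heatEvol 1 (fun y => ‖y‖ ^ (-γ)) x ≤ ENNReal.ofReal (I.toReal + 1) := by
    intro x
    have hle : ∀ y : EuclideanSpace ℝ (Fin N),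
        ENNReal.ofReal (heatKernel 1 (x - y)) * ENNReal.ofReal (‖y‖ ^ (-γ)) ≤
        (Metric.ball 0 1).indicator (fun y => ENNReal.ofReal (‖y‖ ^ (-γ))) y +
          ENNReal.ofReal (heatKernel 1 (x - y)) := by
      intro y
      by_cases hy : y ∈ Metric.ball (0 : EuclideanSpace ℝ (Fin N)) 1
      · rw [indicator_of_mem hy]
        refine le_add_right (mul_le_of_le_one_left' ?_)
        rw [← ENNReal.ofReal_one]
        refine ENNReal.ofReal_le_ofReal ?_
        rw [heatKernel]
        refine mul_le_one₀ ?_ (by positivity) (Real.exp_le_one_iff.2 ?_)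
        · refine Real.rpow_le_one_of_one_le_of_nonpos ?_ ?_
          · nlinarith [Real.pi_gt_three]
          · have : (0 : ℝ) ≤ N := N.cast_nonneg
            linarith
        · rw [neg_div]
          exact neg_nonpos.2 (by positivity)
      · rw [indicator_of_notMem hy, zero_add]
        refine mul_le_of_le_one_right' ?_
        rw [← ENNReal.ofReal_one]
        refine ENNReal.ofReal_le_ofReal (Real.rpow_le_one_of_one_le_of_nonpos ?_ (by linarith))
        simpa using hy
    refine (lintegral_mono hle).trans ?_
    rw [lintegral_add_right _ (measurable_heatKernel_sub 1 x), lintegral_heatKernel_sub one_pos,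
      lintegral_indicator measurableSet_ball, ENNReal.ofReal_add ENNReal.toReal_nonneg zero_le_one,
      ENNReal.ofReal_toReal hIt.ne, ENNReal.ofReal_one]
  refine ⟨I.toReal + 1, by positivity, fun τ hτ x => ?_⟩
  set σ := Real.sqrt τ with hσ
  have hσ0 : 0 < σ := Real.sqrt_pos.2 hτ
  have hσ2 : σ ^ 2 = τ := Real.sq_sqrt hτ.le
  have hscale : heatEvol τ (fun y => ‖y‖ ^ (-γ)) x =
      ENNReal.ofReal (τ ^ (-γ / 2)) *
        heatEvol 1 (fun y => ‖y‖ ^ (-γ)) (σ⁻¹ • x) := by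
    have hme : MeasurableEmbedding (fun y : EuclideanSpace ℝ (Fin N) => σ • y) :=
      (Homeomorph.smulOfNeZero σ hσ0.ne').measurableEmbedding
    have hmap := Measure.map_addHaar_smul (volume : Measure (EuclideanSpace ℝ (Fin N))) hσ0.ne'
    have hvol : (volume : Measure (EuclideanSpace ℝ (Fin N))) = ENNReal.ofReal (σ ^ N) •
        Measure.map (fun y => σ • y) volume := by
      rw [hmap, smul_smul, ← ENNReal.ofReal_mul (by positivity), finrank_euclideanSpace,
        Fintype.card_fin, abs_of_pos (by positivity), mul_inv_cancel₀ (by positivity)]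
      simp
    rw [heatEvol, hvol, lintegral_smul_measure, hme.lintegral_map, smul_eq_mul,
      ← lintegral_const_mul' _ _ ENNReal.ofReal_ne_top, heatEvol,
      ← lintegral_const_mul' _ _ ENNReal.ofReal_ne_top]
    congr 1
    ext y
    have hk : heatKernel τ (x - σ • y) = (σ ^ N)⁻¹ * heatKernel 1 (σ⁻¹ • x - y) := by
      have h1 : x - σ • y = σ • (σ⁻¹ • x - y) := by
        rw [smul_sub, smul_inv_smul₀ hσ0.ne']
      have h2 : τ ^ (-(N : ℝ) / 2) = (σ ^ N)⁻¹ := by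
        rw [← hσ2, ← Real.rpow_natCast σ 2, ← Real.rpow_mul hσ0.le, ← Real.rpow_natCast σ N,
          ← Real.rpow_neg hσ0.le]
        congr 1
        push_cast
        ring
      rw [h1, heatKernel, heatKernel, norm_smul, Real.norm_of_nonneg hσ0.le, mul_pow, hσ2,
        Real.mul_rpow (by positivity) hτ.le, h2, mul_one,
        show -(τ * ‖σ⁻¹ • x - y‖ ^ 2) / (4 * τ) = -‖σ⁻¹ • x - y‖ ^ 2 / (4 * 1) by field_simp]
      ring
    have hn : ‖σ • y‖ ^ (-γ) = τ ^ (-γ / 2) * ‖y‖ ^ (-γ) := by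
      rw [norm_smul, Real.norm_of_nonneg hσ0.le, Real.mul_rpow hσ0.le (norm_nonneg _), ← hσ2,
        ← Real.rpow_natCast σ 2, ← Real.rpow_mul hσ0.le]
      congr 2
      push_cast
      ring
    rw [hk, hn, ENNReal.ofReal_mul (by positivity), ENNReal.ofReal_mul (by positivity), ← mul_assoc,
      ← mul_assoc, ← mul_assoc, ← ENNReal.ofReal_mul (by positivity),
      mul_inv_cancel₀ (by positivity), ENNReal.ofReal_one, one_mul]
    ring
  rw [hscale, mul_comm (I.toReal + 1), ENNReal.ofReal_mul (by positivity)]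
  gcongr
  exact hone _

/-- Completing the square in y: the law of a Brownian bridge from w to x, with time parameter
s(t-s)/t. -/
lemma heatKernel_mul_heatKernel {s t : ℝ} (hs : 0 < s) (hst : s < t)
    (x y w : EuclideanSpace ℝ (Fin N)) :
    heatKernel (t - s) (x - y) * heatKernel s (y - w) =
      heatKernel t (x - w) *
        heatKernel (s * (t - s) / t) ((s / t) • x + ((t - s) / t) • w - y) := by
  have ht : 0 < t := hs.trans hst
  have hts : 0 < t - s := sub_pos.2 hst
  obtain ⟨a, rfl⟩ : ∃ a, x = a + y := ⟨x - y, by simp⟩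
  obtain ⟨b, rfl⟩ : ∃ b, w = y - b := ⟨y - w, by simp⟩
  have h1 : a + y - (y - b) = a + b := by abel
  have h2 : (s / t) • (a + y) + ((t - s) / t) • (y - b) - y = (s / t) • a - ((t - s) / t) • b := by
    have : ((s / t) + ((t - s) / t)) • y = y := by
      rw [← add_div, add_sub_cancel, div_self ht.ne', one_smul]
    rw [add_smul] at this
    rw [smul_add, smul_sub]
    nth_rewrite 3 [← this]
    abel
  rw [h1, h2, add_sub_cancel_right, sub_sub_cancel]
  simp only [heatKernel]
  rw [mul_mul_mul_comm, mul_mul_mul_comm (_ ^ _) _ (_ ^ _), ← Real.exp_add, ← Real.exp_add,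
    ← Real.mul_rpow (by positivity) (by positivity), ← Real.mul_rpow (by positivity) (by positivity)]
  congr 2
  · field_simp
  · rw [norm_add_sq_real, norm_sub_sq_real, norm_smul, norm_smul, real_inner_smul_left,
      real_inner_smul_right, Real.norm_of_nonneg (by positivity), Real.norm_of_nonneg (by positivity)]
    field_simp
    ring

/-- After the kernel product is rewritten, the y-integral is an evolution of |·|^{-γ} at time
s(t-s)/t around a point depending on x and w. The bound by K is uniform in that point, so e^{tΔ}h(x)
factors out. -/
lemma heatEvol_norm_rpow_mul_heatEvol_le {γ K : ℝ}
    (hK : ∀ τ : ℝ, 0 < τ → ∀ x : EuclideanSpace ℝ (Fin N),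
      heatEvol τ (fun y => ‖y‖ ^ (-γ)) x ≤ ENNReal.ofReal (K * τ ^ (-γ / 2)))
    {h : EuclideanSpace ℝ (Fin N) → ℝ} (hh : Measurable h) {s t : ℝ} (hs : 0 < s) (hst : s < t)
    (x : EuclideanSpace ℝ (Fin N)) :
    ∫⁻ y, ENNReal.ofReal (heatKernel (t - s) (x - y)) * ENNReal.ofReal (‖y‖ ^ (-γ)) *
        heatEvol s h y ≤
      ENNReal.ofReal (K * (s * (t - s) / t) ^ (-γ / 2)) * heatEvol t h x := by
  have ht : 0 < t := hs.trans hst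
  have hts : 0 < t - s := sub_pos.2 hst
  have hτ : 0 < s * (t - s) / t := by positivity
  have hm := measurable_heatKernel (N := N)
  calc ∫⁻ y, ENNReal.ofReal (heatKernel (t - s) (x - y)) * ENNReal.ofReal (‖y‖ ^ (-γ)) *
        heatEvol s h y
      = ∫⁻ y, ∫⁻ w, ENNReal.ofReal (heatKernel (t - s) (x - y)) * ENNReal.ofReal (‖y‖ ^ (-γ)) *
          (ENNReal.ofReal (heatKernel s (y - w)) * ENNReal.ofReal (h w)) := by
        refine lintegral_congr fun y => ?_
        rw [heatEvol, lintegral_const_mul' _ _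
          (ENNReal.mul_ne_top ENNReal.ofReal_ne_top ENNReal.ofReal_ne_top)]
    _ = ∫⁻ w, ∫⁻ y, ENNReal.ofReal (heatKernel (t - s) (x - y)) * ENNReal.ofReal (‖y‖ ^ (-γ)) *
          (ENNReal.ofReal (heatKernel s (y - w)) * ENNReal.ofReal (h w)) := by
        refine lintegral_lintegral_swap (Measurable.aemeasurable ?_)
        change Measurable fun p : EuclideanSpace ℝ (Fin N) × EuclideanSpace ℝ (Fin N) =>
          ENNReal.ofReal (heatKernel (t - s) (x - p.1)) * ENNReal.ofReal (‖p.1‖ ^ (-γ)) *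
            (ENNReal.ofReal (heatKernel s (p.1 - p.2)) * ENNReal.ofReal (h p.2))
        refine Measurable.fun_mul (Measurable.fun_mul ?_ (by fun_prop))
          (Measurable.fun_mul ?_ (by fun_prop))
        · exact (hm.comp (measurable_const.prodMk
            (measurable_const.sub measurable_fst))).ennreal_ofReal
        · exact (hm.comp (measurable_const.prodMk
            (measurable_fst.sub measurable_snd))).ennreal_ofReal
    _ = ∫⁻ w, ENNReal.ofReal (heatKernel t (x - w)) * ENNReal.ofReal (h w) *
          heatEvol (s * (t - s) / t) (fun y => ‖y‖ ^ (-γ)) ((s / t) • x + ((t - s) / t) • w) := by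
        refine lintegral_congr fun w => ?_
        rw [heatEvol, ← lintegral_const_mul' _ _
          (ENNReal.mul_ne_top ENNReal.ofReal_ne_top ENNReal.ofReal_ne_top)]
        refine lintegral_congr fun y => ?_
        have := congrArg ENNReal.ofReal (heatKernel_mul_heatKernel hs hst x y w)
        rw [ENNReal.ofReal_mul (heatKernel_nonneg hts _),
          ENNReal.ofReal_mul (heatKernel_nonneg ht _)] at this
        rw [mul_mul_mul_comm, this]
        ring
    _ ≤ ∫⁻ w, ENNReal.ofReal (heatKernel t (x - w)) * ENNReal.ofReal (h w) *
          ENNReal.ofReal (K * (s * (t - s) / t) ^ (-γ / 2)) := by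
        gcongr with w
        exact hK _ hτ _
    _ = _ := by rw [lintegral_mul_const' _ _ ENNReal.ofReal_ne_top, mul_comm]; rfl

end Heat

/-! ### The barrier and its supersolution property. -/

section Supersolution

variable {N : ℕ} {q r : ℝ} {f : ℝ → ℝ}

lemma ClassS.negPowF_rpow (hf : ClassS q f) {u : ℝ} (hu : 0 < u) (p : ℝ) :
    negPowF f r u ^ p = tailReal f u ^ (-(r * p)) := by
  rw [negPowF_eq]
  change (tailReal f u ^ (-r)) ^ p = _
  rw [← Real.rpow_mul (hf.tailReal_pos hu).le, neg_mul]

/-- f F^{1-rδ} increases, which settles a ≤ b. f F^{1+r-rδ} decreases, which settles b ≤ a at the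
cost of (F(b)/F(a))^r = g(a)/g(b). The sum 1 + g(a)/g(b) covers both cases and is affine in g(a),
hence easy to integrate. -/
lemma ClassS.le_of_growth (hf : ClassS q f) (hr : 0 < r) {ξ δ : ℝ} (hξ : 0 < ξ)
    (hup : ∀ u, ξ ≤ u → derivMulF f u ≤ 1 + r - r * δ)
    (hlow : ∀ u, ξ ≤ u → 1 - r * δ ≤ derivMulF f u) {a b : ℝ} (ha : ξ ≤ a) (hb : ξ ≤ b) :
    f a ≤ negPowF f r a ^ (1 / r - δ) * (f b * tailReal f b * negPowF f r b ^ δ) *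
      (1 + negPowF f r a / negPowF f r b) := by
  have ha0 := hξ.trans_le ha
  have hb0 := hξ.trans_le hb
  have hFa := hf.tailReal_pos ha0
  have hFb := hf.tailReal_pos hb0
  have hga := hf.negPowF_pos (r := r) ha0
  have hgb := hf.negPowF_pos (r := r) hb0
  have hfb := hf.pos b hb0
  have hfa := hf.pos a ha0
  have e1 : f a = negPowF f r a ^ (1 / r - δ) * (f a * tailReal f a ^ (1 - r * δ)) := by
    rw [hf.negPowF_rpow ha0, show r * (1 / r - δ) = 1 - r * δ by field_simp, mul_left_comm,
      ← Real.rpow_add hFa, neg_add_cancel, Real.rpow_zero, mul_one]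
  have e2 : f b * tailReal f b * negPowF f r b ^ δ = f b * tailReal f b ^ (1 - r * δ) := by
    rw [hf.negPowF_rpow hb0, mul_assoc, sub_eq_add_neg, Real.rpow_add hFb, Real.rpow_one]
  have hB : 0 < f b * tailReal f b ^ (1 - r * δ) := by positivity
  have key : f a * tailReal f a ^ (1 - r * δ) ≤
      f b * tailReal f b ^ (1 - r * δ) * (1 + negPowF f r a / negPowF f r b) := by
    rcases le_total a b with hab | hab
    · refine (hf.monotoneOn_mul_rpow hξ hlow ha hb hab).trans ?_
      exact le_mul_of_one_le_right hB.le (le_add_of_nonneg_right (by positivity))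
    · have h1 := hf.antitoneOn_mul_rpow hξ hup hb ha hab
      simp only at h1
      rw [show 1 + r - r * δ = (1 - r * δ) + r by ring, Real.rpow_add hFa, Real.rpow_add hFb] at h1
      have h2 : negPowF f r a / negPowF f r b = tailReal f b ^ r / tailReal f a ^ r := by
        rw [negPowF_eq, negPowF_eq]
        change tailReal f a ^ (-r) / tailReal f b ^ (-r) = _
        rw [Real.rpow_neg hFa.le, Real.rpow_neg hFb.le]
        field_simp
      refine le_trans ?_ (mul_le_mul_of_nonneg_left (le_add_of_nonneg_left zero_le_one) hB.le)
      rw [h2, ← mul_div_assoc, le_div_iff₀ (by positivity)]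
      linarith
  rw [e2, mul_assoc]
  nth_rewrite 1 [e1]
  gcongr

/-- The tangent at b gives g(b)/2 = g(b) - g(a) ≤ g'(b)(b - a), and g'(b) = r g(b)/(f(b)F(b)). -/
lemma ClassS.gap_le (hf : ClassS q f) (hr : 0 < r) {ξ : ℝ} (hξ : 0 < ξ)
    (h : ∀ u, ξ ≤ u → derivMulF f u ≤ 1 + r) {a b : ℝ} (ha : ξ ≤ a) (hb : ξ ≤ b)
    (hab : negPowF f r b = 2 * negPowF f r a) : f b * tailReal f b / (2 * r) ≤ b - a := by
  have hb0 := hξ.trans_le hb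
  have hFb := hf.tailReal_pos hb0
  have hfb := hf.pos b hb0
  have ht := hf.negPowF_tangent hr hξ h hb ha
  have h1 : tailReal f b ^ (1 + r) = tailReal f b / negPowF f r b := by
    rw [negPowF_eq]
    change _ = _ / tailReal f b ^ (-r)
    rw [Real.rpow_neg hFb.le, Real.rpow_add hFb, Real.rpow_one, div_inv_eq_mul]
  have hgb := hf.negPowF_pos (r := r) hb0
  have h2 : negPowF f r b / 2 ≤ r * (f b * tailReal f b ^ (1 + r))⁻¹ * (b - a) := by linarith
  rw [h1] at h2
  have h3 : r * (f b * (tailReal f b / negPowF f r b))⁻¹ * (b - a) =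
      (negPowF f r b / 2) * ((2 * r) * (b - a) / (f b * tailReal f b)) := by field_simp
  rw [h3] at h2
  have h4 : 1 ≤ (2 * r) * (b - a) / (f b * tailReal f b) :=
    le_of_mul_le_mul_left (by linarith) (half_pos hgb)
  rw [le_div_iff₀ (by positivity), one_mul] at h4
  rw [div_le_iff₀ (by positivity)]
  linarith

lemma heatEvol_const_mul {c : ℝ} (hc : 0 ≤ c) (t : ℝ) (φ : EuclideanSpace ℝ (Fin N) → ℝ)
    (x : EuclideanSpace ℝ (Fin N)) :
    heatEvol t (fun y => c * φ y) x = ENNReal.ofReal c * heatEvol t φ x := by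
  simp_rw [heatEvol, ENNReal.ofReal_mul hc, mul_left_comm]
  rw [lintegral_const_mul' _ _ ENNReal.ofReal_ne_top]

/-- Jensen's inequality through the tangent at w = g⁻¹(z). As g is known to be convex only beyond ξ,
`u₀` is replaced by max(u₀, ξ), which accounts for the added constant g(ξ). -/
lemma ClassS.heatEvol_le_negPowInv (hf : ClassS q f) (hr : 0 < r) {ξ : ℝ} (hξ : 0 < ξ)
    (h : ∀ u, ξ ≤ u → derivMulF f u ≤ 1 + r) {u₀ : EuclideanSpace ℝ (Fin N) → ℝ}
    (hu₀ : ∀ x, 0 ≤ u₀ x) {t z : ℝ} (ht : 0 < t) {x : EuclideanSpace ℝ (Fin N)}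
    (hz : negPowF f r ξ ≤ z)
    (hle : heatEvol t (fun y => negPowF f r ξ + negPowF f r (u₀ y)) x ≤ ENNReal.ofReal z) :
    heatEvol t u₀ x ≤ ENNReal.ofReal (negPowInv f r z) := by
  set w := negPowInv f r z with hw
  have hwξ : ξ ≤ w := hf.le_negPowInv hr hξ hz
  have hgw : negPowF f r w = z := hf.negPowF_negPowInv hr hξ hz
  have hw0 := hξ.trans_le hwξ
  have hFw := hf.tailReal_pos hw0
  have hfw := hf.pos w hw0
  have hz0 : 0 ≤ z := (negPowF_nonneg _ _ _).trans hz
  set D := f w * tailReal f w ^ (1 + r) / r with hD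
  have hD0 : 0 < D := by positivity
  have hinv : r * (f w * tailReal f w ^ (1 + r))⁻¹ = D⁻¹ := by
    rw [hD, inv_div, div_eq_mul_inv]
  -- Here D = 1/g'(w). The tangent inequality is arranged with nonnegative terms only, so that it
  -- can be integrated in [0, ∞].
  have hpt : ∀ y, D * z + u₀ y ≤ w + D * (negPowF f r ξ + negPowF f r (u₀ y)) := by
    intro y
    have h1 := hf.negPowF_tangent hr hξ h hwξ (le_max_right (u₀ y) ξ)
    rw [hgw, hinv] at h1
    have h2 : negPowF f r (max (u₀ y) ξ) ≤ negPowF f r ξ + negPowF f r (u₀ y) := by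
      rcases max_choice (u₀ y) ξ with h | h <;> rw [h]
      · linarith [negPowF_nonneg f r ξ]
      · linarith [negPowF_nonneg f r (u₀ y)]
    have h3 : D * (z + D⁻¹ * (max (u₀ y) ξ - w)) ≤
        D * (negPowF f r ξ + negPowF f r (u₀ y)) :=
      mul_le_mul_of_nonneg_left (h1.trans h2) hD0.le
    rw [mul_add, mul_inv_cancel_left₀ hD0.ne'] at h3
    linarith [le_max_left (u₀ y) ξ]
  have h4 := heatEvol_mono (t := t) hpt x
  rw [heatEvol_const_add ht (by positivity) hu₀, heatEvol_const_add ht hw0.le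
    (fun y => mul_nonneg hD0.le (add_nonneg (negPowF_nonneg _ _ _) (negPowF_nonneg _ _ _))),
    heatEvol_const_mul hD0.le] at h4
  have h5 : ENNReal.ofReal (D * z) + heatEvol t u₀ x ≤
      ENNReal.ofReal (D * z) + ENNReal.ofReal w := by
    refine h4.trans ?_
    rw [add_comm, ENNReal.ofReal_mul hD0.le]
    gcongr
  exact (ENNReal.add_le_add_iff_left ENNReal.ofReal_ne_top).1 h5

/-- A Beta integral bounded by hand: on each half of (0, t) one factor is nonsingular and comparable
to a power of t. -/
lemma lintegral_rpow_mul_rpow_le {a b t : ℝ} (ha0 : 0 ≤ a) (ha : a < 1) (hb0 : 0 ≤ b) (hb : b < 1)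
    (ht : 0 < t) :
    ∫⁻ s in Ioo 0 t, ENNReal.ofReal (s ^ (-a) * (t - s) ^ (-b)) ≤
      ENNReal.ofReal ((2 / (1 - a) + 2 / (1 - b)) * t ^ (1 - a - b)) := by
  have hint : ∀ c : ℝ, c < 1 → IntegrableOn (fun s : ℝ => s ^ (-c)) (Ioo 0 t) := fun c hc =>
    (intervalIntegral.integrableOn_Ioo_rpow_iff ht).2 (by linarith)
  have hval : ∀ c : ℝ, c < 1 →
      ∫⁻ s in Ioo 0 t, ENNReal.ofReal (s ^ (-c)) = ENNReal.ofReal (t ^ (1 - c) / (1 - c)) := by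
    intro c hc
    rw [← ofReal_integral_eq_lintegral_ofReal (hint c hc)
      ((ae_restrict_iff' measurableSet_Ioo).2 (ae_of_all _ fun s hs => Real.rpow_nonneg hs.1.le _)),
      ← integral_Ioc_eq_integral_Ioo, ← intervalIntegral.integral_of_le ht.le,
      integral_rpow (Or.inl (by linarith)), Real.zero_rpow (by linarith)]
    ring_nf
  have hrefl : ∫⁻ s in Ioo 0 t, ENNReal.ofReal ((t - s) ^ (-b)) =
      ∫⁻ s in Ioo 0 t, ENNReal.ofReal (s ^ (-b)) := by
    rw [← lintegral_indicator measurableSet_Ioo, ← lintegral_indicator measurableSet_Ioo,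
      ← lintegral_sub_left_eq_self ((Ioo 0 t).indicator fun s => ENNReal.ofReal (s ^ (-b))) t]
    congr 1
    ext s
    by_cases hs : s ∈ Ioo 0 t
    · rw [indicator_of_mem hs, indicator_of_mem (by constructor <;> linarith [hs.1, hs.2])]
    · rw [indicator_of_notMem hs, indicator_of_notMem]
      exact fun h => hs (by constructor <;> linarith [h.1, h.2])
  have htwo : ∀ c : ℝ, c < 1 → 0 ≤ c → (t / 2) ^ (-c) ≤ 2 * t ^ (-c) := by
    intro c hc hc0
    rw [Real.div_rpow ht.le zero_le_two, Real.rpow_neg zero_le_two, div_inv_eq_mul, mul_comm]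
    gcongr
    calc (2 : ℝ) ^ c ≤ 2 ^ (1 : ℝ) := Real.rpow_le_rpow_of_exponent_le one_le_two hc.le
      _ = 2 := Real.rpow_one 2
  have hpt : ∀ s ∈ Ioo 0 t, ENNReal.ofReal (s ^ (-a) * (t - s) ^ (-b)) ≤
      ENNReal.ofReal (2 * t ^ (-b)) * ENNReal.ofReal (s ^ (-a)) +
        ENNReal.ofReal (2 * t ^ (-a)) * ENNReal.ofReal ((t - s) ^ (-b)) := by
    intro s hs
    have hs0 := hs.1
    have hts : 0 < t - s := sub_pos.2 hs.2
    rw [← ENNReal.ofReal_mul (by positivity), ← ENNReal.ofReal_mul (by positivity),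
      ← ENNReal.ofReal_add (by positivity) (by positivity)]
    refine ENNReal.ofReal_le_ofReal ?_
    rcases le_total s (t / 2) with h | h
    · have : (t - s) ^ (-b) ≤ 2 * t ^ (-b) :=
        (Real.rpow_le_rpow_of_nonpos (by positivity) (by linarith) (by linarith)).trans
          (htwo b hb hb0)
      refine le_add_of_le_of_nonneg ?_ (by positivity)
      rw [mul_comm]
      gcongr
    · have : s ^ (-a) ≤ 2 * t ^ (-a) :=
        (Real.rpow_le_rpow_of_nonpos (by positivity) (by linarith) (by linarith)).trans
          (htwo a ha ha0)
      refine le_add_of_nonneg_of_le (by positivity) ?_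
      gcongr
  refine (setLIntegral_mono' measurableSet_Ioo hpt).trans (le_of_eq ?_)
  have h1a : 0 < 1 - a := by linarith
  have h1b : 0 < 1 - b := by linarith
  rw [lintegral_add_left (by fun_prop), lintegral_const_mul' _ _ ENNReal.ofReal_ne_top,
    lintegral_const_mul' _ _ ENNReal.ofReal_ne_top, hrefl, hval a ha, hval b hb,
    ← ENNReal.ofReal_mul (by positivity), ← ENNReal.ofReal_mul (by positivity),
    ← ENNReal.ofReal_add (by positivity) (by positivity)]
  congr 1
  have e1 : t ^ (1 - a - b) = t ^ (-b) * t ^ (1 - a) := by rw [← Real.rpow_add ht]; ring_nf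
  have e2 : t ^ (1 - a - b) = t ^ (-a) * t ^ (1 - b) := by rw [← Real.rpow_add ht]; ring_nf
  rw [add_mul]
  nth_rewrite 1 [e1]
  rw [e2]
  ring

/-- The barrier `w` with `F(w)^{-r} = 2 e^{tΔ} h`. -/
noncomputable def barrier (f : ℝ → ℝ) (r : ℝ) (h : EuclideanSpace ℝ (Fin N) → ℝ) (t : ℝ)
    (x : EuclideanSpace ℝ (Fin N)) : ℝ :=
  negPowInv f r (2 * (heatEvol t h x).toReal)

lemma ClassS.lintegral_barrier_le (hf : ClassS q f) (hr : 0 < r) {ξ δ : ℝ} (hξ : 0 < ξ)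
    (hδ0 : 0 ≤ δ) (hδ : δ ≤ 1 / r)
    (hup : ∀ u, ξ ≤ u → derivMulF f u ≤ 1 + r - r * δ)
    (hlow : ∀ u, ξ ≤ u → 1 - r * δ ≤ derivMulF f u)
    {γ K : ℝ} (hγ0 : 0 < γ) (hK0 : 0 < K)
    (hK : ∀ τ : ℝ, 0 < τ → ∀ x : EuclideanSpace ℝ (Fin N),
      heatEvol τ (fun y => ‖y‖ ^ (-γ)) x ≤ ENNReal.ofReal (K * τ ^ (-γ / 2)))
    (ha : (N : ℝ) / 2 * (1 / r - δ) + γ / 2 < 1) {h : EuclideanSpace ℝ (Fin N) → ℝ}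
    (hh : Measurable h) (hhξ : ∀ x, negPowF f r ξ ≤ h x) {E T : ℝ} (hE : 0 < E)
    (hbound : ∀ t ∈ Ioo 0 T, ∀ x, 2 * heatEvol t h x ≤ ENNReal.ofReal (E * t ^ (-(N : ℝ) / 2)))
    {t : ℝ} (ht : t ∈ Ioo 0 T) (x : EuclideanSpace ℝ (Fin N)) :
    ∫⁻ s in Ioo 0 t, heatEvol (t - s) (fun y => ‖y‖ ^ (-γ) * f (barrier f r h s y)) x ≤
      ENNReal.ofReal (f (barrier f r h t x) * tailReal f (barrier f r h t x) *
        (E ^ (1 / r) * (2 * K) * (2 / (1 - ((N : ℝ) / 2 * (1 / r - δ) + γ / 2)) +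
          2 / (1 - γ / 2)) * t ^ (1 - γ / 2 - N / (2 * r)))) := by
  have hN0 : (0 : ℝ) ≤ N := N.cast_nonneg
  have hδ' : 0 ≤ 1 / r - δ := by linarith
  have hNδ : 0 ≤ (N : ℝ) / 2 * (1 / r - δ) := by positivity
  have hg0 := hf.negPowF_pos (r := r) hξ
  have hfin : ∀ s ∈ Ioo 0 T, ∀ y, heatEvol s h y ≠ ∞ := by
    intro s hs y htop
    have := hbound s hs y
    rw [htop, ENNReal.mul_top two_ne_zero, top_le_iff] at this
    exact ENNReal.ofReal_ne_top this
  have hge : ∀ s ∈ Ioo 0 T, ∀ y, negPowF f r ξ ≤ (heatEvol s h y).toReal := by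
    intro s hs y
    rw [← ENNReal.ofReal_le_iff_le_toReal (hfin s hs y), ← heatEvol_const hs.1 (negPowF f r ξ) y]
    exact heatEvol_mono hhξ y
  have hge2 : ∀ s ∈ Ioo 0 T, ∀ y, negPowF f r ξ ≤ 2 * (heatEvol s h y).toReal := fun s hs y => by
    linarith [hge s hs y]
  have hle : ∀ s ∈ Ioo 0 T, ∀ y, 2 * (heatEvol s h y).toReal ≤ E * s ^ (-(N : ℝ) / 2) := by
    intro s hs y
    have h1 := ENNReal.toReal_mono ENNReal.ofReal_ne_top (hbound s hs y)
    rw [ENNReal.toReal_mul, ENNReal.toReal_ofReal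
      (mul_nonneg hE.le (Real.rpow_nonneg hs.1.le _))] at h1
    simpa using h1
  have hbξ : ∀ s ∈ Ioo 0 T, ∀ y, ξ ≤ barrier f r h s y := fun s hs y =>
    hf.le_negPowInv hr hξ (hge2 s hs y)
  have hgb : ∀ s ∈ Ioo 0 T, ∀ y, negPowF f r (barrier f r h s y) = 2 * (heatEvol s h y).toReal :=
    fun s hs y => hf.negPowF_negPowInv hr hξ (hge2 s hs y)
  have ht0 := ht.1
  set b := barrier f r h t x with hbdef
  set Y := (heatEvol t h x).toReal with hY
  have hY0 : 0 < Y := hg0.trans_le (hge t ht x)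
  have hbpos : 0 < b := hξ.trans_le (hbξ t ht x)
  have hfb := hf.pos b hbpos
  have hFb := hf.tailReal_pos hbpos
  set A := f b * tailReal f b * (E * t ^ (-(N : ℝ) / 2)) ^ δ with hA
  have hA0 : 0 < A := by positivity
  -- The growth comparison with b = w(x,t). Both powers of e^{·Δ}h are replaced by their sup bounds;
  -- only the ratio is kept pointwise.
  have hstep : ∀ s ∈ Ioo 0 t,
      heatEvol (t - s) (fun y => ‖y‖ ^ (-γ) * f (barrier f r h s y)) x ≤
      ENNReal.ofReal ((E * s ^ (-(N : ℝ) / 2)) ^ (1 / r - δ) * A *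
        (2 * K * (s * (t - s) / t) ^ (-γ / 2))) := by
    intro s hs
    have hsT : s ∈ Ioo 0 T := ⟨hs.1, hs.2.trans ht.2⟩
    have hs0 := hs.1
    have hts : 0 < t - s := sub_pos.2 hs.2
    set P := (E * s ^ (-(N : ℝ) / 2)) ^ (1 / r - δ) * A with hP
    have hP0 : 0 < P := by positivity
    have hpt : ∀ y, ENNReal.ofReal (heatKernel (t - s) (x - y)) *
        ENNReal.ofReal (‖y‖ ^ (-γ) * f (barrier f r h s y)) ≤
        ENNReal.ofReal P * (ENNReal.ofReal (heatKernel (t - s) (x - y)) *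
          ENNReal.ofReal (‖y‖ ^ (-γ)) + ENNReal.ofReal Y⁻¹ *
          (ENNReal.ofReal (heatKernel (t - s) (x - y)) * ENNReal.ofReal (‖y‖ ^ (-γ)) *
            heatEvol s h y)) := by
      intro y
      have hS0 : 0 < (heatEvol s h y).toReal := hg0.trans_le (hge s hsT y)
      have h1 : f (barrier f r h s y) ≤ P * (1 + (heatEvol s h y).toReal / Y) := by
        refine (hf.le_of_growth hr hξ hup hlow (hbξ s hsT y) (hbξ t ht x)).trans ?_
        rw [hgb s hsT y, hgb t ht x, mul_div_mul_left _ _ two_ne_zero]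
        refine mul_le_mul_of_nonneg_right ?_ (by positivity)
        refine mul_le_mul ?_ ?_ (by positivity) (by positivity)
        · exact Real.rpow_le_rpow (by positivity) (hle s hsT y) hδ'
        · exact mul_le_mul_of_nonneg_left (Real.rpow_le_rpow (by positivity) (hle t ht x) hδ0)
            (by positivity)
      have h2 : ENNReal.ofReal (f (barrier f r h s y)) ≤
          ENNReal.ofReal P * (1 + ENNReal.ofReal Y⁻¹ * heatEvol s h y) := by
        refine (ENNReal.ofReal_le_ofReal h1).trans (le_of_eq ?_)
        rw [ENNReal.ofReal_mul hP0.le, ENNReal.ofReal_add zero_le_one (by positivity),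
          ENNReal.ofReal_one, div_eq_inv_mul, ENNReal.ofReal_mul (inv_nonneg.2 hY0.le),
          ENNReal.ofReal_toReal (hfin s hsT y)]
      rw [ENNReal.ofReal_mul (by positivity)]
      calc _ ≤ ENNReal.ofReal (heatKernel (t - s) (x - y)) * (ENNReal.ofReal (‖y‖ ^ (-γ)) *
            (ENNReal.ofReal P * (1 + ENNReal.ofReal Y⁻¹ * heatEvol s h y))) := by gcongr
        _ = _ := by ring
    refine (lintegral_mono hpt).trans ?_
    rw [lintegral_const_mul' _ _ ENNReal.ofReal_ne_top, ENNReal.ofReal_mul hP0.le]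
    refine mul_le_mul_right ?_ _
    rw [lintegral_add_left ((measurable_heatKernel_sub _ _).fun_mul (by fun_prop)),
      lintegral_const_mul' _ _ ENNReal.ofReal_ne_top]
    have hτ : 0 < s * (t - s) / t := by positivity
    have hfirst : heatEvol (t - s) (fun y => ‖y‖ ^ (-γ)) x ≤
        ENNReal.ofReal (K * (s * (t - s) / t) ^ (-γ / 2)) := by
      refine (hK _ hts x).trans (ENNReal.ofReal_le_ofReal ?_)
      refine mul_le_mul_of_nonneg_left
        (Real.rpow_le_rpow_of_nonpos hτ ?_ (by linarith)) hK0.le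
      rw [div_le_iff₀ ht0, mul_comm]
      exact mul_le_mul_of_nonneg_left hs.2.le hts.le
    -- The evolution of h at (x, t) produced here is exactly Y and cancels Y⁻¹.
    have hsecond : ENNReal.ofReal Y⁻¹ * ∫⁻ y, ENNReal.ofReal (heatKernel (t - s) (x - y)) *
        ENNReal.ofReal (‖y‖ ^ (-γ)) * heatEvol s h y ≤
        ENNReal.ofReal (K * (s * (t - s) / t) ^ (-γ / 2)) := by
      refine (mul_le_mul_right (heatEvol_norm_rpow_mul_heatEvol_le hK hh hs.1 hs.2 x) _).trans
        (le_of_eq ?_)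
      rw [← ENNReal.ofReal_toReal (hfin t ht x), mul_left_comm, ← ENNReal.ofReal_mul (by positivity),
        inv_mul_cancel₀ hY0.ne', ENNReal.ofReal_one, mul_one]
    refine (add_le_add hfirst hsecond).trans (le_of_eq ?_)
    rw [← ENNReal.ofReal_add (by positivity) (by positivity)]
    congr 1
    ring
  refine (setLIntegral_mono' measurableSet_Ioo hstep).trans ?_
  set a := (N : ℝ) / 2 * (1 / r - δ) + γ / 2 with hadef
  have hcongr : ∀ s ∈ Ioo 0 t, ENNReal.ofReal ((E * s ^ (-(N : ℝ) / 2)) ^ (1 / r - δ) * A *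
        (2 * K * (s * (t - s) / t) ^ (-γ / 2))) =
      ENNReal.ofReal (E ^ (1 / r - δ) * A * (2 * K) * t ^ (γ / 2)) *
        ENNReal.ofReal (s ^ (-a) * (t - s) ^ (-(γ / 2))) := by
    intro s hs
    have hs0 := hs.1
    have hts : 0 < t - s := sub_pos.2 hs.2
    rw [← ENNReal.ofReal_mul (by positivity)]
    congr 1
    have e1 : (E * s ^ (-(N : ℝ) / 2)) ^ (1 / r - δ) =
        E ^ (1 / r - δ) * s ^ (-((N : ℝ) / 2 * (1 / r - δ))) := by
      rw [Real.mul_rpow hE.le (by positivity), ← Real.rpow_mul hs0.le]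
      congr 2
      ring
    have e2 : (s * (t - s) / t) ^ (-γ / 2) = s ^ (-(γ / 2)) * (t - s) ^ (-(γ / 2)) * t ^ (γ / 2) := by
      rw [Real.div_rpow (by positivity) ht0.le, Real.mul_rpow hs0.le hts.le, neg_div,
        Real.rpow_neg ht0.le, div_inv_eq_mul]
    have e3 : s ^ (-a) = s ^ (-((N : ℝ) / 2 * (1 / r - δ))) * s ^ (-(γ / 2)) := by
      rw [← Real.rpow_add hs0, hadef]
      congr 1
      ring
    rw [e1, e2, e3]
    ring
  rw [setLIntegral_congr_fun measurableSet_Ioo hcongr,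
    lintegral_const_mul' _ _ ENNReal.ofReal_ne_top]
  refine (mul_le_mul_right (lintegral_rpow_mul_rpow_le (by positivity) ha (by positivity)
    (by linarith) ht0) _).trans (le_of_eq ?_)
  rw [← ENNReal.ofReal_mul (by positivity)]
  congr 1
  have e4 : (E * t ^ (-(N : ℝ) / 2)) ^ δ = E ^ δ * t ^ (-((N : ℝ) / 2 * δ)) := by
    rw [Real.mul_rpow hE.le (by positivity), ← Real.rpow_mul ht0.le]
    congr 2
    ring
  -- The powers with δ recombine, so δ affects only the convergence of the time integral, not the
  -- powers of E and t.
  have e5 : E ^ (1 / r) = E ^ (1 / r - δ) * E ^ δ := by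
    rw [← Real.rpow_add hE]
    congr 1
    ring
  have e6 : t ^ (1 - γ / 2 - N / (2 * r)) =
      t ^ (γ / 2) * t ^ (1 - a - γ / 2) * t ^ (-((N : ℝ) / 2 * δ)) := by
    rw [← Real.rpow_add ht0, ← Real.rpow_add ht0, hadef]
    congr 1
    field_simp
    ring
  rw [hA, e4, e5, e6]
  ring

/-- Jensen bounds the linear part by a, and `hsmall` makes the Duhamel integral at most
f(b)F(b)/(2r) ≤ b - a. -/
lemma ClassS.barrier_supersolution (hf : ClassS q f) (hr : 0 < r) {ξ δ : ℝ} (hξ : 0 < ξ)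
    (hδ0 : 0 ≤ δ) (hδ : δ ≤ 1 / r)
    (hup : ∀ u, ξ ≤ u → derivMulF f u ≤ 1 + r - r * δ)
    (hlow : ∀ u, ξ ≤ u → 1 - r * δ ≤ derivMulF f u)
    {γ K : ℝ} (hγ0 : 0 < γ) (hK0 : 0 < K)
    (hK : ∀ τ : ℝ, 0 < τ → ∀ x : EuclideanSpace ℝ (Fin N),
      heatEvol τ (fun y => ‖y‖ ^ (-γ)) x ≤ ENNReal.ofReal (K * τ ^ (-γ / 2)))
    (ha : (N : ℝ) / 2 * (1 / r - δ) + γ / 2 < 1) {u₀ : EuclideanSpace ℝ (Fin N) → ℝ}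
    (hu₀ : ∀ x, 0 ≤ u₀ x) (hum : Measurable u₀) {E T : ℝ} (hE : 0 < E)
    (hbound : ∀ t ∈ Ioo 0 T, ∀ x,
      2 * heatEvol t (fun y => negPowF f r ξ + negPowF f r (u₀ y)) x ≤
        ENNReal.ofReal (E * t ^ (-(N : ℝ) / 2)))
    (hsmall : ∀ t ∈ Ioo 0 T, E ^ (1 / r) * (2 * K) *
      (2 / (1 - ((N : ℝ) / 2 * (1 / r - δ) + γ / 2)) + 2 / (1 - γ / 2)) *
        t ^ (1 - γ / 2 - N / (2 * r)) ≤ 1 / (2 * r))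
    {t : ℝ} (ht : t ∈ Ioo 0 T) (x : EuclideanSpace ℝ (Fin N)) :
    heatEvol t u₀ x + ∫⁻ s in Ioo 0 t, heatEvol (t - s) (fun y => ‖y‖ ^ (-γ) *
        f (barrier f r (fun y => negPowF f r ξ + negPowF f r (u₀ y)) s y)) x ≤
      ENNReal.ofReal (barrier f r (fun y => negPowF f r ξ + negPowF f r (u₀ y)) t x) := by
  set h : EuclideanSpace ℝ (Fin N) → ℝ := fun y => negPowF f r ξ + negPowF f r (u₀ y) with hh
  have hhξ : ∀ x, negPowF f r ξ ≤ h x := fun x => le_add_of_nonneg_right (negPowF_nonneg _ _ _)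
  have hhm : Measurable h := ((measurable_negPowF f r).comp hum).const_add _
  have hup' : ∀ u, ξ ≤ u → derivMulF f u ≤ 1 + r := fun u hu =>
    (hup u hu).trans (by nlinarith)
  have hfin : heatEvol t h x ≠ ∞ := by
    intro htop
    have := hbound t ht x
    rw [htop, ENNReal.mul_top two_ne_zero, top_le_iff] at this
    exact ENNReal.ofReal_ne_top this
  have hge : negPowF f r ξ ≤ (heatEvol t h x).toReal := by
    rw [← ENNReal.ofReal_le_iff_le_toReal hfin, ← heatEvol_const ht.1 (negPowF f r ξ) x]
    exact heatEvol_mono hhξ x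
  have hge2 : negPowF f r ξ ≤ 2 * (heatEvol t h x).toReal := by
    linarith [negPowF_nonneg f r ξ]
  have h1 := hf.heatEvol_le_negPowInv hr hξ hup' hu₀ ht.1 hge (ENNReal.ofReal_toReal hfin).ge
  have h2 := hf.lintegral_barrier_le hr hξ hδ0 hδ hup hlow hγ0 hK0 hK ha hhm hhξ hE hbound ht x
  set a := negPowInv f r (heatEvol t h x).toReal with hadef
  set b := barrier f r h t x with hbdef
  have haξ : ξ ≤ a := hf.le_negPowInv hr hξ hge
  have hbξ : ξ ≤ b := hf.le_negPowInv hr hξ hge2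
  have hb0 := hξ.trans_le hbξ
  have hgap : f b * tailReal f b / (2 * r) ≤ b - a := by
    refine hf.gap_le hr hξ hup' haξ hbξ ?_
    rw [hadef, hf.negPowF_negPowInv hr hξ hge, hbdef, barrier, hf.negPowF_negPowInv hr hξ hge2]
  have h3 := mul_le_mul_of_nonneg_left (hsmall t ht)
    (mul_pos (hf.pos b hb0) (hf.tailReal_pos hb0)).le
  rw [mul_one_div] at h3
  have hba : 0 ≤ b - a := le_trans
    (div_nonneg (mul_pos (hf.pos b hb0) (hf.tailReal_pos hb0)).le (by positivity)) hgap
  refine (add_le_add h1 (h2.trans (ENNReal.ofReal_le_ofReal (h3.trans hgap)))).trans (le_of_eq ?_)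
  rw [← ENNReal.ofReal_add (hξ.le.trans haξ) hba, add_sub_cancel]

end Supersolution

/-! ### From a supersolution to a solution by monotone iteration. -/

section Iteration

variable {N : ℕ} {q : ℝ} {f : ℝ → ℝ}

open Classical in
/-- The Duhamel map on `(0, T)`, extended by zero to other times. -/
noncomputable def duhamelMap (T γ : ℝ) (f : ℝ → ℝ) (u₀ : EuclideanSpace ℝ (Fin N) → ℝ)
    (U : ℝ → EuclideanSpace ℝ (Fin N) → ℝ≥0∞) (t : ℝ) (x : EuclideanSpace ℝ (Fin N)) : ℝ≥0∞ :=
  if t ∈ Ioo 0 T then heatEvol t u₀ x +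
    ∫⁻ s in Ioo 0 t, heatEvol (t - s) (fun y => ‖y‖ ^ (-γ) * f (U s y).toReal) x else 0

lemma measurable_heatEvol {φ : EuclideanSpace ℝ (Fin N) → ℝ} (hφ : Measurable φ) :
    Measurable fun p : ℝ × EuclideanSpace ℝ (Fin N) => heatEvol p.1 φ p.2 := by
  refine Measurable.lintegral_prod_right' (f := fun p : (ℝ × EuclideanSpace ℝ (Fin N)) ×
    EuclideanSpace ℝ (Fin N) => ENNReal.ofReal (heatKernel p.1.1 (p.1.2 - p.2)) *
      ENNReal.ofReal (φ p.2)) ?_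
  refine Measurable.fun_mul (Measurable.ennreal_ofReal ?_) (by fun_prop)
  exact measurable_heatKernel.comp (measurable_fst.fst.prodMk
    (measurable_fst.snd.sub measurable_snd))

lemma ClassS.measurable_comp_toReal (hf : ClassS q f) {α : Type*} [MeasurableSpace α]
    {U : α → ℝ≥0∞} (hU : Measurable U) : Measurable fun a => f (U a).toReal := by
  have h1 : Continuous fun v : ℝ => f (max v 0) :=
    hf.continuousOn.comp_continuous (by fun_prop) fun v => le_max_right v 0
  have h2 : (fun a => f (U a).toReal) = fun a => f (max (U a).toReal 0) := by
    ext a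
    rw [max_eq_left ENNReal.toReal_nonneg]
  rw [h2]
  exact h1.measurable.comp hU.ennreal_toReal

lemma ClassS.measurable_duhamelMap (hf : ClassS q f) (T γ : ℝ)
    {u₀ : EuclideanSpace ℝ (Fin N) → ℝ} (hu₀ : Measurable u₀)
    {U : ℝ → EuclideanSpace ℝ (Fin N) → ℝ≥0∞} (hU : Measurable (Function.uncurry U)) :
    Measurable (Function.uncurry (duhamelMap T γ f u₀ U)) := by
  classical
  refine Measurable.ite (measurableSet_Ioo.preimage measurable_fst) ?_ measurable_const
  refine (measurable_heatEvol hu₀).add ?_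
  have h1 : ∀ p : ℝ × EuclideanSpace ℝ (Fin N),
      ∫⁻ s in Ioo 0 p.1, heatEvol (p.1 - s) (fun y => ‖y‖ ^ (-γ) * f (U s y).toReal) p.2 =
      ∫⁻ s, if 0 < s ∧ s < p.1 then
        heatEvol (p.1 - s) (fun y => ‖y‖ ^ (-γ) * f (U s y).toReal) p.2 else 0 := by
    intro p
    rw [← lintegral_indicator measurableSet_Ioo]
    refine lintegral_congr fun s => ?_
    by_cases hs : 0 < s ∧ s < p.1
    · rw [indicator_of_mem (show s ∈ Ioo 0 p.1 from hs), if_pos hs]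
    · rw [indicator_of_notMem (show s ∉ Ioo 0 p.1 from hs), if_neg hs]
  simp_rw [h1]
  refine Measurable.lintegral_prod_right' (f := fun z : (ℝ × EuclideanSpace ℝ (Fin N)) × ℝ =>
    if 0 < z.2 ∧ z.2 < z.1.1 then
      heatEvol (z.1.1 - z.2) (fun y => ‖y‖ ^ (-γ) * f (U z.2 y).toReal) z.1.2 else 0) ?_
  refine Measurable.ite ?_ ?_ measurable_const
  · exact (measurableSet_lt measurable_const measurable_snd).inter
      (measurableSet_lt measurable_snd measurable_fst.fst)
  · refine Measurable.lintegral_prod_right' (f := fun z : ((ℝ × EuclideanSpace ℝ (Fin N)) × ℝ) ×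
      EuclideanSpace ℝ (Fin N) => ENNReal.ofReal (heatKernel (z.1.1.1 - z.1.2) (z.1.1.2 - z.2)) *
        ENNReal.ofReal (‖z.2‖ ^ (-γ) * f (U z.1.2 z.2).toReal)) ?_
    refine Measurable.fun_mul (Measurable.ennreal_ofReal ?_) (Measurable.ennreal_ofReal ?_)
    · exact measurable_heatKernel.comp ((measurable_fst.fst.fst.sub measurable_fst.snd).prodMk
        (measurable_fst.fst.snd.sub measurable_snd))
    · exact Measurable.fun_mul (by fun_prop) (hf.measurable_comp_toReal
        (hU.comp (measurable_fst.snd.prodMk measurable_snd)))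

lemma ClassS.duhamelMap_mono (hf : ClassS q f) (T γ : ℝ) (u₀ : EuclideanSpace ℝ (Fin N) → ℝ)
    {U V : ℝ → EuclideanSpace ℝ (Fin N) → ℝ≥0∞} (hV : ∀ t x, V t x ≠ ∞)
    (h : ∀ t x, U t x ≤ V t x) (t : ℝ) (x : EuclideanSpace ℝ (Fin N)) :
    duhamelMap T γ f u₀ U t x ≤ duhamelMap T γ f u₀ V t x := by
  unfold duhamelMap
  split_ifs with ht
  · gcongr with s
    refine heatEvol_mono (fun y => ?_) x
    refine mul_le_mul_of_nonneg_left ?_ (by positivity)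
    exact hf.monotoneOn ENNReal.toReal_nonneg ENNReal.toReal_nonneg
      (ENNReal.toReal_mono (hV s y) (h s y))
  · exact le_rfl

lemma ClassS.ofReal_comp_iSup (hf : ClassS q f) {v : ℕ → ℝ≥0∞} (hv : Monotone v)
    (htop : ⨆ n, v n ≠ ∞) :
    ENNReal.ofReal (f (⨆ n, v n).toReal) = ⨆ n, ENNReal.ofReal (f (v n).toReal) := by
  have hle : ∀ n, v n ≤ ⨆ n, v n := le_iSup v
  have hvt : ∀ n, v n ≠ ∞ := fun n => ne_top_of_le_ne_top htop (hle n)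
  have hlim : Tendsto (fun n => (v n).toReal) atTop (𝓝 (⨆ n, v n).toReal) :=
    (ENNReal.tendsto_toReal htop).comp (tendsto_atTop_iSup hv)
  have hlim2 : Tendsto (fun n => f (v n).toReal) atTop (𝓝 (f (⨆ n, v n).toReal)) := by
    refine Tendsto.comp (hf.continuousOn _ ENNReal.toReal_nonneg) ?_
    exact tendsto_nhdsWithin_iff.2 ⟨hlim, Eventually.of_forall fun n => ENNReal.toReal_nonneg⟩
  refine tendsto_nhds_unique (ENNReal.tendsto_ofReal hlim2) (tendsto_atTop_iSup ?_)
  intro m n hmn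
  exact ENNReal.ofReal_le_ofReal (hf.monotoneOn ENNReal.toReal_nonneg ENNReal.toReal_nonneg
    (ENNReal.toReal_mono (hvt n) (hv hmn)))

/-- Continuity and monotonicity of f pass the supremum through f; monotone convergence, used in
space and then in time, does the rest. -/
lemma ClassS.duhamelMap_iSup (hf : ClassS q f) (T γ : ℝ) (u₀ : EuclideanSpace ℝ (Fin N) → ℝ)
    {U : ℕ → ℝ → EuclideanSpace ℝ (Fin N) → ℝ≥0∞} (hU : ∀ n, Measurable (Function.uncurry (U n)))
    (hmono : ∀ t x, Monotone fun n => U n t x) (htop : ∀ t x, ⨆ n, U n t x ≠ ∞)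
    (t : ℝ) (x : EuclideanSpace ℝ (Fin N)) :
    duhamelMap T γ f u₀ (fun t x => ⨆ n, U n t x) t x = ⨆ n, duhamelMap T γ f u₀ (U n) t x := by
  unfold duhamelMap
  split_ifs with ht
  · rw [← ENNReal.add_iSup]
    congr 1
    have hpt : ∀ n m, n ≤ m → ∀ s y,
        ENNReal.ofReal (‖y‖ ^ (-γ) * f (U n s y).toReal) ≤
          ENNReal.ofReal (‖y‖ ^ (-γ) * f (U m s y).toReal) := by
      intro n m hnm s y
      refine ENNReal.ofReal_le_ofReal (mul_le_mul_of_nonneg_left ?_ (by positivity))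
      exact hf.monotoneOn ENNReal.toReal_nonneg ENNReal.toReal_nonneg (ENNReal.toReal_mono
        (ne_top_of_le_ne_top (htop s y) (le_iSup (fun n => U n s y) m)) (hmono s y hnm))
    have hmeas : ∀ n, Measurable fun z : ℝ × EuclideanSpace ℝ (Fin N) =>
        ENNReal.ofReal (heatKernel (t - z.1) (x - z.2)) *
          ENNReal.ofReal (‖z.2‖ ^ (-γ) * f (U n z.1 z.2).toReal) := by
      intro n
      refine Measurable.fun_mul (Measurable.ennreal_ofReal ?_) (Measurable.ennreal_ofReal ?_)
      · exact measurable_heatKernel.comp ((measurable_const.sub measurable_fst).prodMk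
          (measurable_const.sub measurable_snd))
      · exact Measurable.fun_mul (by fun_prop) (hf.measurable_comp_toReal (hU n))
    have hsup : ∀ s y, ENNReal.ofReal (‖y‖ ^ (-γ) * f (⨆ n, U n s y).toReal) =
        ⨆ n, ENNReal.ofReal (‖y‖ ^ (-γ) * f (U n s y).toReal) := by
      intro s y
      have hn : 0 ≤ ‖y‖ ^ (-γ) := by positivity
      rw [ENNReal.ofReal_mul hn, hf.ofReal_comp_iSup (hmono s y) (htop s y), ENNReal.mul_iSup]
      exact iSup_congr fun n => (ENNReal.ofReal_mul hn).symm
    have hinner : ∀ s, heatEvol (t - s) (fun y => ‖y‖ ^ (-γ) * f (⨆ n, U n s y).toReal) x =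
        ⨆ n, heatEvol (t - s) (fun y => ‖y‖ ^ (-γ) * f (U n s y).toReal) x := by
      intro s
      unfold heatEvol
      simp_rw [hsup, ENNReal.mul_iSup]
      refine lintegral_iSup (fun n => ?_) ?_
      · have h1 : Measurable fun y : EuclideanSpace ℝ (Fin N) => (s, y) := measurable_prodMk_left
        have h2 := (hmeas n).comp h1
        exact h2
      · exact fun n m hnm y => mul_le_mul_right (hpt n m hnm s y) _
    rw [setLIntegral_congr_fun measurableSet_Ioo fun s _ => hinner s]
    refine lintegral_iSup (fun n => ?_) ?_
    · exact Measurable.lintegral_prod_right' (hmeas n)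
    · exact fun n m hnm s => lintegral_mono fun y => mul_le_mul_right (hpt n m hnm s y) _
  · simp

/-- The iterates of the Duhamel map from 0 increase and stay below w, so their supremum is finite
and a fixed point. -/
theorem ClassS.exists_le_of_supersolution (hf : ClassS q f) (T γ : ℝ)
    {u₀ : EuclideanSpace ℝ (Fin N) → ℝ} (hu₀ : Measurable u₀)
    {w : ℝ → EuclideanSpace ℝ (Fin N) → ℝ} (hw0 : ∀ t x, 0 ≤ w t x)
    (hw : ∀ t ∈ Ioo 0 T, ∀ x, heatEvol t u₀ x +
      ∫⁻ s in Ioo 0 t, heatEvol (t - s) (fun y => ‖y‖ ^ (-γ) * f (w s y)) x ≤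
        ENNReal.ofReal (w t x)) :
    ∃ u : ℝ → EuclideanSpace ℝ (Fin N) → ℝ, Measurable (Function.uncurry u) ∧
      (∀ t x, 0 ≤ u t x) ∧ (∀ t x, u t x ≤ w t x) ∧
      ∀ t ∈ Ioo 0 T, ∀ x, ENNReal.ofReal (u t x) = heatEvol t u₀ x +
        ∫⁻ s in Ioo 0 t, heatEvol (t - s) (fun y => ‖y‖ ^ (-γ) * f (u s y)) x := by
  set W : ℝ → EuclideanSpace ℝ (Fin N) → ℝ≥0∞ := fun t x => ENNReal.ofReal (w t x) with hW
  have hWt : ∀ t x, W t x ≠ ∞ := fun t x => ENNReal.ofReal_ne_top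
  have hWW : ∀ t x, duhamelMap T γ f u₀ W t x ≤ W t x := by
    intro t x
    unfold duhamelMap
    split_ifs with ht
    · refine le_trans (le_of_eq ?_) (hw t ht x)
      simp_rw [hW, ENNReal.toReal_ofReal (hw0 _ _)]
    · exact bot_le
  set U : ℕ → ℝ → EuclideanSpace ℝ (Fin N) → ℝ≥0∞ :=
    fun n => (duhamelMap T γ f u₀)^[n] fun _ _ => 0 with hUdef
  have hUs : ∀ n, U (n + 1) = duhamelMap T γ f u₀ (U n) := fun n =>
    Function.iterate_succ_apply' _ _ _
  have hUW : ∀ n t x, U n t x ≤ W t x := by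
    intro n
    induction n with
    | zero => exact fun t x => bot_le
    | succ n ih =>
      intro t x
      rw [hUs]
      exact (hf.duhamelMap_mono T γ u₀ hWt ih t x).trans (hWW t x)
  have hUt : ∀ n t x, U n t x ≠ ∞ := fun n t x => ne_top_of_le_ne_top (hWt t x) (hUW n t x)
  have hUsucc : ∀ n t x, U n t x ≤ U (n + 1) t x := by
    intro n
    induction n with
    | zero => exact fun t x => bot_le
    | succ n ih =>
      intro t x
      rw [hUs n, hUs (n + 1)]
      exact hf.duhamelMap_mono T γ u₀ (hUt (n + 1)) ih t x
  have hUm : ∀ n, Measurable (Function.uncurry (U n)) := by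
    intro n
    induction n with
    | zero => exact measurable_const
    | succ n ih => rw [hUs]; exact hf.measurable_duhamelMap T γ hu₀ ih
  have hmono : ∀ t x, Monotone fun n => U n t x := fun t x =>
    monotone_nat_of_le_succ fun n => hUsucc n t x
  have hsupW : ∀ t x, ⨆ n, U n t x ≤ W t x := fun t x => iSup_le fun n => hUW n t x
  have hsup : ∀ t x, ⨆ n, U n t x ≠ ∞ := fun t x => ne_top_of_le_ne_top (hWt t x) (hsupW t x)
  have hfix : ∀ t x, ⨆ n, U n t x = duhamelMap T γ f u₀ (fun t x => ⨆ n, U n t x) t x := by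
    intro t x
    rw [hf.duhamelMap_iSup T γ u₀ hUm hmono hsup, ← (hmono t x).iSup_nat_add 1]
    simp_rw [hUs]
  refine ⟨fun t x => (⨆ n, U n t x).toReal, ?_, fun t x => ENNReal.toReal_nonneg, ?_, ?_⟩
  · exact (Measurable.iSup hUm).ennreal_toReal
  · intro t x
    exact ENNReal.toReal_le_of_le_ofReal (hw0 t x) (hsupW t x)
  · intro t ht x
    rw [ENNReal.ofReal_toReal (hsup t x), hfix t x, duhamelMap, if_pos ht]

end Iteration

/-! ### Regularity of the solution, and the choice of δ, E and T. -/

section Existence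

variable {N : ℕ} {q r : ℝ} {f : ℝ → ℝ}

lemma heatEvol_congr_ae {φ ψ : EuclideanSpace ℝ (Fin N) → ℝ} (h : φ =ᵐ[volume] ψ) (t : ℝ)
    (x : EuclideanSpace ℝ (Fin N)) : heatEvol t φ x = heatEvol t ψ x :=
  lintegral_congr_ae (h.mono fun y hy => by simp only [hy])

lemma ulNorm_congr_ae {φ ψ : EuclideanSpace ℝ (Fin N) → ℝ} (h : φ =ᵐ[volume] ψ) :
    ulNorm φ = ulNorm ψ :=
  iSup_congr fun _ => lintegral_congr_ae (ae_restrict_of_ae (h.mono fun y hy => by simp only [hy]))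

lemma ulNorm_const_add_le {c : ℝ} (hc : 0 ≤ c) (φ : EuclideanSpace ℝ (Fin N) → ℝ) :
    ulNorm (fun x => c + φ x) ≤
      ENNReal.ofReal c * volume (Metric.ball (0 : EuclideanSpace ℝ (Fin N)) 1) + ulNorm φ := by
  refine iSup_le fun y => ?_
  calc ∫⁻ x in Metric.ball y 1, ‖c + φ x‖ₑ
      ≤ ∫⁻ x in Metric.ball y 1, (ENNReal.ofReal c + ‖φ x‖ₑ) := by
        refine lintegral_mono fun x => (enorm_add_le _ _).trans ?_
        rw [Real.enorm_of_nonneg hc]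
    _ = ENNReal.ofReal c * volume (Metric.ball (0 : EuclideanSpace ℝ (Fin N)) 1) +
          ∫⁻ x in Metric.ball y 1, ‖φ x‖ₑ := by
        rw [lintegral_add_left measurable_const, setLIntegral_const,
          Measure.addHaar_ball_center volume y]
    _ ≤ _ := by
        gcongr
        exact le_iSup (fun z => ∫⁻ x in Metric.ball z 1, ‖φ x‖ₑ) y

lemma ulNorm_le_of_le_heatEvol {t c d : ℝ} (ht : 0 < t) {φ ψ : EuclideanSpace ℝ (Fin N) → ℝ}
    (hφ : Measurable φ) (hψ : ∀ x, 0 ≤ ψ x)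
    (h : ∀ x, ENNReal.ofReal (ψ x) ≤ ENNReal.ofReal c + ENNReal.ofReal d * heatEvol t φ x) :
    ulNorm ψ ≤ ENNReal.ofReal c * volume (Metric.ball (0 : EuclideanSpace ℝ (Fin N)) 1) +
      ENNReal.ofReal d * ulNorm φ := by
  refine iSup_le fun y => ?_
  calc ∫⁻ x in Metric.ball y 1, ‖ψ x‖ₑ
      ≤ ∫⁻ x in Metric.ball y 1, (ENNReal.ofReal c + ENNReal.ofReal d * heatEvol t φ x) := by
        refine lintegral_mono fun x => ?_
        rw [Real.enorm_of_nonneg (hψ x)]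
        exact h x
    _ = ENNReal.ofReal c * volume (Metric.ball (0 : EuclideanSpace ℝ (Fin N)) 1) +
          ENNReal.ofReal d * ∫⁻ x in Metric.ball y 1, heatEvol t φ x := by
        rw [lintegral_add_left measurable_const, setLIntegral_const,
          Measure.addHaar_ball_center volume y, lintegral_const_mul' _ _ ENNReal.ofReal_ne_top]
    _ ≤ _ := by
        gcongr
        exact ulNorm_heatEvol_le ht hφ y

/-- The bounded part costs M without any singularity at t = 0; only the approximation error carries
t^{-N/2}. -/
lemma heatEvol_le_of_bounded_approx {C : ℝ}
    (hC : ∀ φ : EuclideanSpace ℝ (Fin N) → ℝ, Measurable φ → ∀ t : ℝ, 0 < t → t ≤ 1 →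
      ∀ x, heatEvol t φ x ≤ ENNReal.ofReal (C * t ^ (-(N : ℝ) / 2)) * ulNorm φ)
    {φ g : EuclideanSpace ℝ (Fin N) → ℝ} (hφ : Measurable φ) (hg : Measurable g) {M t : ℝ}
    (hM : ∀ x, |g x| ≤ M) (ht : 0 < t) (ht1 : t ≤ 1) (x : EuclideanSpace ℝ (Fin N)) :
    heatEvol t φ x ≤ ENNReal.ofReal M +
      ENNReal.ofReal (C * t ^ (-(N : ℝ) / 2)) * ulNorm (fun x => φ x - g x) := by
  have hM0 : 0 ≤ M := (abs_nonneg _).trans (hM x)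
  have h1 : ∀ y, φ y ≤ M + |φ y - g y| := fun y => by
    linarith [le_abs_self (φ y - g y), le_abs_self (g y), hM y]
  refine (heatEvol_mono h1 x).trans ?_
  rw [heatEvol_const_add ht hM0 fun y => abs_nonneg _]
  gcongr
  have h2 : ulNorm (fun x => |φ x - g x|) = ulNorm (fun x => φ x - g x) := by
    simp [ulNorm]
  rw [← h2]
  exact hC _ (by fun_prop) t ht ht1 x

lemma ClassS.exists_solution_of_heatEvol_bound (hf : ClassS q f) (hr : 0 < r) {ξ δ : ℝ}
    (hξ : 0 < ξ) (hδ0 : 0 ≤ δ) (hδ : δ ≤ 1 / r)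
    (hup : ∀ u, ξ ≤ u → derivMulF f u ≤ 1 + r - r * δ)
    (hlow : ∀ u, ξ ≤ u → 1 - r * δ ≤ derivMulF f u)
    {γ K : ℝ} (hγ0 : 0 < γ) (hK0 : 0 < K)
    (hK : ∀ τ : ℝ, 0 < τ → ∀ x : EuclideanSpace ℝ (Fin N),
      heatEvol τ (fun y => ‖y‖ ^ (-γ)) x ≤ ENNReal.ofReal (K * τ ^ (-γ / 2)))
    (ha : (N : ℝ) / 2 * (1 / r - δ) + γ / 2 < 1) {u₀ : EuclideanSpace ℝ (Fin N) → ℝ}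
    (hu₀ : ∀ x, 0 ≤ u₀ x) (hum : Measurable u₀) (hul : ulNorm (fun x => negPowF f r (u₀ x)) < ∞)
    {E T : ℝ} (hE : 0 < E)
    (hbound : ∀ t ∈ Ioo 0 T, ∀ x,
      2 * heatEvol t (fun y => negPowF f r ξ + negPowF f r (u₀ y)) x ≤
        ENNReal.ofReal (E * t ^ (-(N : ℝ) / 2)))
    (hsmall : ∀ t ∈ Ioo 0 T, E ^ (1 / r) * (2 * K) *
      (2 / (1 - ((N : ℝ) / 2 * (1 / r - δ) + γ / 2)) + 2 / (1 - γ / 2)) *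
        t ^ (1 - γ / 2 - N / (2 * r)) ≤ 1 / (2 * r)) :
    ∃ u : ℝ → EuclideanSpace ℝ (Fin N) → ℝ, IsLocalSolution γ f u₀ T u ∧
      ∀ t ∈ Ioo 0 T, MemUL (fun x => negPowF f r (u t x)) ∧
        ulNorm (fun x => negPowF f r (u t x)) ≤ 2 * (ENNReal.ofReal (negPowF f r ξ) *
          volume (Metric.ball (0 : EuclideanSpace ℝ (Fin N)) 1) +
            ulNorm (fun x => negPowF f r (u₀ x))) := by
  set h : EuclideanSpace ℝ (Fin N) → ℝ := fun y => negPowF f r ξ + negPowF f r (u₀ y) with hh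
  set V := volume (Metric.ball (0 : EuclideanSpace ℝ (Fin N)) 1) with hV
  have hVt : V < ∞ := measure_ball_lt_top
  have hhξ : ∀ x, negPowF f r ξ ≤ h x := fun x => le_add_of_nonneg_right (negPowF_nonneg _ _ _)
  have hhm : Measurable h := ((measurable_negPowF f r).comp hum).const_add _
  have hhul : ulNorm h ≤ ENNReal.ofReal (negPowF f r ξ) * V +
      ulNorm (fun x => negPowF f r (u₀ x)) := ulNorm_const_add_le (negPowF_nonneg _ _ _) _
  have hhfin : ulNorm h < ∞ := hhul.trans_lt
    (ENNReal.add_lt_top.2 ⟨ENNReal.mul_lt_top ENNReal.ofReal_lt_top hVt, hul⟩)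
  have hup' : ∀ u, ξ ≤ u → derivMulF f u ≤ 1 + r := fun u hu => (hup u hu).trans (by nlinarith)
  obtain ⟨u, hu_meas, hu_nonneg, hu_le, hu_eq⟩ :=
    hf.exists_le_of_supersolution T γ hum (w := barrier f r h)
      (fun t x => negPowInv_nonneg f r _)
      (fun t ht x => hf.barrier_supersolution hr hξ hδ0 hδ hup hlow hγ0 hK0 hK ha hu₀ hum hE
        hbound hsmall ht x)
  have hfin : ∀ t ∈ Ioo 0 T, ∀ x, heatEvol t h x ≠ ∞ := by
    intro t ht x htop
    have := hbound t ht x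
    rw [htop, ENNReal.mul_top two_ne_zero, top_le_iff] at this
    exact ENNReal.ofReal_ne_top this
  have hge2 : ∀ t ∈ Ioo 0 T, ∀ x, negPowF f r ξ ≤ 2 * (heatEvol t h x).toReal := by
    intro t ht x
    have : negPowF f r ξ ≤ (heatEvol t h x).toReal := by
      rw [← ENNReal.ofReal_le_iff_le_toReal (hfin t ht x),
        ← heatEvol_const ht.1 (negPowF f r ξ) x]
      exact heatEvol_mono hhξ x
    linarith [negPowF_nonneg f r ξ]
  have hFu : ∀ t ∈ Ioo 0 T, ∀ x, negPowF f r (u t x) ≤ 2 * (heatEvol t h x).toReal := by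
    intro t ht x
    rw [← hf.negPowF_negPowInv hr hξ (hge2 t ht x)]
    exact (hf.negPowF_strictMonoOn hr).monotoneOn (hu_nonneg t x) (negPowInv_nonneg f r _)
      (hu_le t x)
  have hFξ := hf.tailReal_pos hξ
  have hfξ := hf.pos ξ hξ
  set D := f ξ * tailReal f ξ ^ (1 + r) / r with hD
  have hD0 : 0 < D := by positivity
  -- Convex g grows at least linearly: the tangent at ξ, of slope 1/D, turns bounds on e^{tΔ}h into
  -- both the L¹_ul and the L^∞ bounds on u.
  have hlin : ∀ t ∈ Ioo 0 T, ∀ x, u t x ≤ ξ + D * (2 * (heatEvol t h x).toReal) := by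
    intro t ht x
    have h1 := hf.negPowF_tangent hr hξ hup' le_rfl (hf.le_negPowInv hr hξ (hge2 t ht x))
    rw [hf.negPowF_negPowInv hr hξ (hge2 t ht x),
      show r * (f ξ * tailReal f ξ ^ (1 + r))⁻¹ = D⁻¹ by
        rw [hD, inv_div, div_eq_mul_inv]] at h1
    have h2 : D⁻¹ * (negPowInv f r (2 * (heatEvol t h x).toReal) - ξ) ≤
        2 * (heatEvol t h x).toReal := by linarith [negPowF_nonneg f r ξ]
    rw [inv_mul_le_iff₀ hD0] at h2
    have h3 := hu_le t x
    rw [barrier] at h3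
    linarith
  have hum_t : ∀ t, Measurable (u t) := fun t => hu_meas.comp measurable_prodMk_left
  have hulu : ∀ t ∈ Ioo 0 T, ulNorm (u t) ≤
      ENNReal.ofReal ξ * V + ENNReal.ofReal (D * 2) * ulNorm h := by
    intro t ht
    refine ulNorm_le_of_le_heatEvol ht.1 hhm (hu_nonneg t) fun x => ?_
    refine (ENNReal.ofReal_le_ofReal (hlin t ht x)).trans (le_of_eq ?_)
    rw [ENNReal.ofReal_add hξ.le (by positivity), ← mul_assoc,
      ENNReal.ofReal_mul (by positivity : 0 ≤ D * 2), ENNReal.ofReal_toReal (hfin t ht x)]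
  have hulF : ∀ t ∈ Ioo 0 T, ulNorm (fun x => negPowF f r (u t x)) ≤ 2 * ulNorm h := by
    intro t ht
    have := ulNorm_le_of_le_heatEvol (c := 0) (d := 2) (ψ := fun x => negPowF f r (u t x))
      ht.1 hhm (fun x => negPowF_nonneg _ _ _) fun x => by
        refine (ENNReal.ofReal_le_ofReal (hFu t ht x)).trans (le_of_eq ?_)
        rw [ENNReal.ofReal_mul zero_le_two, ENNReal.ofReal_toReal (hfin t ht x),
          ENNReal.ofReal_zero, zero_add]
    simpa using this
  refine ⟨u, ⟨hu_meas.aemeasurable, fun t _ x => hu_nonneg t x, ?_, ?_, ?_⟩, ?_⟩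
  · have hB : ENNReal.ofReal ξ * V + ENNReal.ofReal (D * 2) * ulNorm h < ∞ :=
      ENNReal.add_lt_top.2 ⟨ENNReal.mul_lt_top ENNReal.ofReal_lt_top hVt,
        ENNReal.mul_lt_top ENNReal.ofReal_lt_top hhfin⟩
    refine ⟨(ENNReal.ofReal ξ * V + ENNReal.ofReal (D * 2) * ulNorm h).toNNReal, ?_⟩
    rw [ENNReal.coe_toNNReal hB.ne]
    refine (ae_restrict_iff' measurableSet_Ioo).2 (ae_of_all _ fun t ht => ?_)
    exact ⟨⟨(hum_t t).aestronglyMeasurable, (hulu t ht).trans_lt hB⟩, hulu t ht⟩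
  · intro a b ha0 hbT
    refine ⟨(ξ + D * (E * a ^ (-(N : ℝ) / 2))).toNNReal, ?_⟩
    refine (ae_restrict_iff' measurableSet_Icc).2 (ae_of_all _ fun t ht => ?_)
    have htT : t ∈ Ioo 0 T := ⟨ha0.trans_le ht.1, ht.2.trans_lt hbT⟩
    rw [eLpNorm_exponent_top]
    refine eLpNormEssSup_le_of_ae_bound (ae_of_all _ fun x => ?_)
    rw [Real.norm_of_nonneg (hu_nonneg t x)]
    refine (hlin t htT x).trans ?_
    gcongr ξ + D * ?_
    have h1 := ENNReal.toReal_mono ENNReal.ofReal_ne_top (hbound t htT x)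
    rw [ENNReal.toReal_mul, ENNReal.toReal_ofReal
      (mul_nonneg hE.le (Real.rpow_nonneg htT.1.le _))] at h1
    refine le_trans (by simpa using h1) (mul_le_mul_of_nonneg_left ?_ hE.le)
    refine Real.rpow_le_rpow_of_nonpos ha0 ht.1 ?_
    have : (0 : ℝ) ≤ N := N.cast_nonneg
    linarith
  · exact fun t ht => ae_of_all _ (hu_eq t ht)
  · intro t ht
    have h1 := (hulF t ht).trans (mul_le_mul_right hhul 2)
    refine ⟨⟨((measurable_negPowF f r).comp (hum_t t)).aestronglyMeasurable, ?_⟩, h1⟩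
    exact (hulF t ht).trans_lt (ENNReal.mul_lt_top (by simp) hhfin)

/-- For q < 1 + r, any small δ > 0 puts the limit q strictly between 1 - rδ and 1 + r - rδ. For q =
1 + r one takes δ = 0: the upper bound is then the extra hypothesis, and 1 < q gives the lower one.
-/
lemma ClassS.exists_threshold (hf : ClassS q f) (hr : 0 < r) (hq : 1 ≤ q)
    (h : q < 1 + r ∨ q = 1 + r ∧ ∀ᶠ ξ in atTop, derivMulF f ξ ≤ q) :
    ∃ δ ξ : ℝ, 0 ≤ δ ∧ δ ≤ 1 / r ∧ (q < 1 + r → 0 < δ) ∧ 0 < ξ ∧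
      (∀ u, ξ ≤ u → derivMulF f u ≤ 1 + r - r * δ) ∧
      (∀ u, ξ ≤ u → 1 - r * δ ≤ derivMulF f u) := by
  suffices H : ∃ δ : ℝ, 0 ≤ δ ∧ δ ≤ 1 / r ∧ (q < 1 + r → 0 < δ) ∧
      (∀ᶠ u in atTop, derivMulF f u ≤ 1 + r - r * δ) ∧ 1 - r * δ < q by
    obtain ⟨δ, h0, h1, h2, h3, h4⟩ := H
    obtain ⟨ξ, hξ⟩ := ((h3.and (hf.tendsto.eventually_const_le h4)).and
      (eventually_gt_atTop 0)).exists_forall_of_atTop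
    exact ⟨δ, ξ, h0, h1, h2, (hξ ξ le_rfl).2, fun u hu => (hξ u hu).1.1,
      fun u hu => (hξ u hu).1.2⟩
  rcases h with h | ⟨h, h'⟩
  · have hpos : 0 < min (1 / r) ((1 + r - q) / (2 * r)) :=
      lt_min (by positivity) (div_pos (by linarith) (by positivity))
    refine ⟨min (1 / r) ((1 + r - q) / (2 * r)), hpos.le, min_le_left _ _, fun _ => hpos, ?_, ?_⟩
    · refine hf.tendsto.eventually_le_const ?_
      have : r * min (1 / r) ((1 + r - q) / (2 * r)) ≤ r * ((1 + r - q) / (2 * r)) :=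
        mul_le_mul_of_nonneg_left (min_le_right _ _) hr.le
      have h2 : r * ((1 + r - q) / (2 * r)) = (1 + r - q) / 2 := by field_simp
      linarith
    · linarith [mul_pos hr hpos]
  · refine ⟨0, le_rfl, by positivity, fun hlt => absurd h hlt.ne, ?_, by linarith⟩
    filter_upwards [h'] with u hu
    linarith

lemma exists_time_subcritical {κ c ε : ℝ} (hκ : 0 < κ) (hε : 0 < ε) :
    ∃ T : ℝ, 0 < T ∧ T ≤ 1 ∧ ∀ t ∈ Ioo 0 T, c * t ^ κ ≤ ε := by
  have h1 : Tendsto (fun t : ℝ => c * t ^ κ) (𝓝 0) (𝓝 0) := by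
    have h2 : ContinuousAt (fun t : ℝ => c * t ^ κ) 0 :=
      (Real.continuousAt_rpow_const 0 κ (Or.inr hκ.le)).const_mul c
    simpa [ContinuousAt, Real.zero_rpow hκ.ne'] using h2
  obtain ⟨η, hη, h3⟩ := Metric.eventually_nhds_iff.1 (h1.eventually_le_const hε)
  refine ⟨min η 1, lt_min hη one_pos, min_le_right _ _, fun t ht => h3 ?_⟩
  rw [Real.dist_0_eq_abs, abs_of_pos ht.1]
  exact ht.2.trans_le (min_le_left _ _)

lemma one_le_rpow_neg_half (N : ℕ) {t : ℝ} (ht : 0 < t) (ht1 : t ≤ 1) :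
    1 ≤ t ^ (-(N : ℝ) / 2) := by
  refine Real.one_le_rpow_of_pos_of_le_one_of_nonpos ht ht1 ?_
  have : (0 : ℝ) ≤ N := N.cast_nonneg
  linarith

lemma exists_bound_of_ulNorm_lt_top {C : ℝ} (hC0 : 0 ≤ C)
    (hC : ∀ φ : EuclideanSpace ℝ (Fin N) → ℝ, Measurable φ → ∀ t : ℝ, 0 < t → t ≤ 1 →
      ∀ x, heatEvol t φ x ≤ ENNReal.ofReal (C * t ^ (-(N : ℝ) / 2)) * ulNorm φ)
    {φ : EuclideanSpace ℝ (Fin N) → ℝ} (hφ : Measurable φ) (hφ0 : ∀ x, 0 ≤ φ x)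
    (hul : ulNorm φ < ∞) {v : ℝ} (hv : 0 < v) :
    ∃ E : ℝ, 0 < E ∧ ∀ t : ℝ, 0 < t → t ≤ 1 → ∀ x,
      2 * heatEvol t (fun y => v + φ y) x ≤ ENNReal.ofReal (E * t ^ (-(N : ℝ) / 2)) := by
  refine ⟨2 * (v + C * (ulNorm φ).toReal), by positivity, fun t ht ht1 x => ?_⟩
  rw [heatEvol_const_add ht hv.le hφ0]
  have h1 := one_le_rpow_neg_half N ht ht1
  calc 2 * (ENNReal.ofReal v + heatEvol t φ x)
      ≤ ENNReal.ofReal 2 * (ENNReal.ofReal v + ENNReal.ofReal (C * t ^ (-(N : ℝ) / 2)) *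
          ENNReal.ofReal (ulNorm φ).toReal) := by
        rw [ENNReal.ofReal_toReal hul.ne, ENNReal.ofReal_ofNat]
        gcongr
        exact hC φ hφ t ht ht1 x
    _ = ENNReal.ofReal (2 * (v + C * t ^ (-(N : ℝ) / 2) * (ulNorm φ).toReal)) := by
        rw [← ENNReal.ofReal_mul (by positivity), ← ENNReal.ofReal_add hv.le (by positivity),
          ← ENNReal.ofReal_mul zero_le_two]
    _ ≤ _ := by
        refine ENNReal.ofReal_le_ofReal ?_
        nlinarith

/-- Here E is prescribed, as small as desired; the price is the length of the time interval. -/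
lemma exists_bound_of_approx (hN : 1 ≤ N) {C : ℝ} (hC0 : 0 ≤ C)
    (hC : ∀ φ : EuclideanSpace ℝ (Fin N) → ℝ, Measurable φ → ∀ t : ℝ, 0 < t → t ≤ 1 →
      ∀ x, heatEvol t φ x ≤ ENNReal.ofReal (C * t ^ (-(N : ℝ) / 2)) * ulNorm φ)
    {φ : EuclideanSpace ℝ (Fin N) → ℝ} (hφ : Measurable φ) (hφ0 : ∀ x, 0 ≤ φ x)
    (happ : ∀ ε : ℝ≥0∞, 0 < ε → ∃ g : EuclideanSpace ℝ (Fin N) → ℝ,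
      UniformContinuous g ∧ (∃ M : ℝ, ∀ x, |g x| ≤ M) ∧ ulNorm (fun x => φ x - g x) < ε)
    {v : ℝ} (hv : 0 < v) {E : ℝ} (hE : 0 < E) :
    ∃ T : ℝ, 0 < T ∧ T ≤ 1 ∧ ∀ t ∈ Ioo 0 T, ∀ x,
      2 * heatEvol t (fun y => v + φ y) x ≤ ENNReal.ofReal (E * t ^ (-(N : ℝ) / 2)) := by
  -- The approximation error then contributes 2Cε ≤ E/2; the bounded part takes the other E/2 for
  -- small t, since t^{N/2} → 0.
  have hε : 0 < E / (4 * (C + 1)) := by positivity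
  obtain ⟨g, hg, ⟨M, hM⟩, hgε⟩ := happ _ (ENNReal.ofReal_pos.2 hε)
  have hM0 : 0 ≤ M := (abs_nonneg _).trans (hM 0)
  have hN2 : 0 < (N : ℝ) / 2 := by
    have : (1 : ℝ) ≤ N := by exact_mod_cast hN
    positivity
  obtain ⟨T, hT, hT1, hTs⟩ := exists_time_subcritical (c := 2 * (v + M)) hN2 (half_pos hE)
  refine ⟨T, hT, hT1, fun t ht x => ?_⟩
  have ht1 : t ≤ 1 := ht.2.le.trans hT1
  have ht0 := ht.1
  rw [heatEvol_const_add ht.1 hv.le hφ0]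
  have h1 := heatEvol_le_of_bounded_approx hC hφ hg.continuous.measurable hM ht.1 ht1 x
  set p := t ^ (-(N : ℝ) / 2) with hp
  have hp0 : 0 < p := Real.rpow_pos_of_pos ht.1 _
  calc 2 * (ENNReal.ofReal v + heatEvol t φ x)
      ≤ ENNReal.ofReal 2 * (ENNReal.ofReal v + (ENNReal.ofReal M + ENNReal.ofReal (C * p) *
          ENNReal.ofReal (E / (4 * (C + 1))))) := by
        rw [ENNReal.ofReal_ofNat]
        gcongr
        exact h1.trans (by gcongr)
    _ = ENNReal.ofReal (2 * (v + (M + C * p * (E / (4 * (C + 1)))))) := by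
        rw [← ENNReal.ofReal_mul (by positivity), ← ENNReal.ofReal_add hM0 (by positivity),
          ← ENNReal.ofReal_add hv.le (by positivity), ← ENNReal.ofReal_mul zero_le_two]
    _ ≤ _ := by
        refine ENNReal.ofReal_le_ofReal ?_
        have h2 : 2 * (v + M) ≤ E / 2 * p := by
          have h3 := mul_le_mul_of_nonneg_right (hTs t ht) hp0.le
          rw [hp, neg_div]
          rwa [mul_assoc, hp, neg_div, ← Real.rpow_add ht0, add_neg_cancel, Real.rpow_zero,
            mul_one] at h3
        have h4 : C * (E / (4 * (C + 1))) ≤ E / 4 := by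
          rw [← mul_div_assoc, div_le_div_iff₀ (by positivity) (by norm_num)]
          nlinarith
        nlinarith

end Existence

end HardyParabolic

/-! ### The main theorem. -/

open HardyParabolic in
theorem mainTheorem1 (N : ℕ) (hN : 1 ≤ N) (q : ℝ) (hq : 1 ≤ q) (f : ℝ → ℝ)
    (hf : HardyParabolic.ClassS q f) (u₀ : EuclideanSpace ℝ (Fin N) → ℝ)
    (hu₀ : ∀ x, 0 ≤ u₀ x) (r : ℝ) :
    ∃ C : ℝ≥0, 0 < C ∧ ∀ γ : ℝ, 0 < γ → γ < min 2 (N : ℝ) →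
      ((N : ℝ) / (2 - γ) < r ∧ q < 1 + r ∧
          HardyParabolic.MemUL (fun x => HardyParabolic.negPowF f r (u₀ x))) ∨
        ((N : ℝ) / (2 - γ) < r ∧ q = 1 + r ∧
          HardyParabolic.MemUL (fun x => HardyParabolic.negPowF f r (u₀ x)) ∧
          ∀ᶠ ξ in atTop, HardyParabolic.derivMulF f ξ ≤ q) ∨
        (r = (N : ℝ) / (2 - γ) ∧ q < 1 + r ∧
          HardyParabolic.MemULClosure (fun x => HardyParabolic.negPowF f r (u₀ x))) →
      ∃ T : ℝ, 0 < T ∧ ∃ u : ℝ → EuclideanSpace ℝ (Fin N) → ℝ,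
        HardyParabolic.IsLocalSolution γ f u₀ T u ∧
        ∀ t ∈ Ioo 0 T,
          HardyParabolic.MemUL (fun x => HardyParabolic.negPowF f r (u t x)) ∧
          HardyParabolic.ulNorm (fun x => HardyParabolic.negPowF f r (u t x)) ≤ C := by
  have hN0 : (1 : ℝ) ≤ N := by exact_mod_cast hN
  -- C must be fixed before γ, so the γ-free consequences of (i)–(iii) are isolated. If they fail,
  -- no admissible γ satisfies a hypothesis and any C works. Otherwise δ, ξ and then C are chosen
  -- without γ.
  by_cases hcond : 0 < r ∧ MemUL (fun x => negPowF f r (u₀ x)) ∧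
      (q < 1 + r ∨ q = 1 + r ∧ ∀ᶠ ξ in atTop, derivMulF f ξ ≤ q)
  swap
  · refine ⟨1, one_pos, fun γ hγ0 hγ h => absurd ?_ hcond⟩
    have hpos : 0 < (N : ℝ) / (2 - γ) :=
      div_pos (by linarith) (sub_pos.2 (hγ.trans_le (min_le_left _ _)))
    rcases h with ⟨h1, h2, h3⟩ | ⟨h1, h2, h3, h4⟩ | ⟨h1, h2, h3⟩
    · exact ⟨hpos.trans h1, h3, Or.inl h2⟩
    · exact ⟨hpos.trans h1, h3, Or.inr ⟨h2, h4⟩⟩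
    · exact ⟨h1 ▸ hpos, h3.1, Or.inl h2⟩
  obtain ⟨hr, hul, hqr⟩ := hcond
  obtain ⟨δ, ξ, hδ0, hδ, hδpos, hξ, hup, hlow⟩ := hf.exists_threshold hr hq hqr
  set B := 2 * (ENNReal.ofReal (negPowF f r ξ) *
    volume (Metric.ball (0 : EuclideanSpace ℝ (Fin N)) 1) +
      ulNorm (fun x => negPowF f r (u₀ x))) with hB
  have hBt : B < ∞ := ENNReal.mul_lt_top (by simp) (ENNReal.add_lt_top.2
    ⟨ENNReal.mul_lt_top ENNReal.ofReal_lt_top measure_ball_lt_top, hul.2⟩)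
  refine ⟨B.toNNReal + 1, by positivity, fun γ hγ0 hγ h => ?_⟩
  have hγ2 : 0 < 2 - γ := sub_pos.2 (hγ.trans_le (min_le_left _ _))
  have hγN : γ < N := hγ.trans_le (min_le_right _ _)
  -- Measurability of `u₀` is not assumed; it follows from u₀ = g⁻¹(g(u₀)).
  have hu₀m : AEMeasurable u₀ := by
    have h1 := (hf.negPowInv_monotone hr).measurable.comp_aemeasurable hul.1.aemeasurable
    refine h1.congr (ae_of_all _ fun x => ?_)
    exact hf.negPowInv_negPowF hr (hu₀ x)
  set w : EuclideanSpace ℝ (Fin N) → ℝ := fun x => max (hu₀m.mk u₀ x) 0 with hw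
  have hwm : Measurable w := hu₀m.measurable_mk.max measurable_const
  have hw0 : ∀ x, 0 ≤ w x := fun x => le_max_right _ _
  have hwe : u₀ =ᵐ[volume] w := hu₀m.ae_eq_mk.mono fun x hx => by
    rw [hw]
    change u₀ x = max (hu₀m.mk u₀ x) 0
    rw [← hx, max_eq_left (hu₀ x)]
  have hφe : (fun x => negPowF f r (u₀ x)) =ᵐ[volume] fun x => negPowF f r (w x) :=
    hwe.mono fun x hx => by simp only [hx]
  have hφm : Measurable fun x => negPowF f r (w x) := (measurable_negPowF f r).comp hwm
  have hulw : ulNorm (fun x => negPowF f r (w x)) < ∞ := by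
    rw [← ulNorm_congr_ae hφe]; exact hul.2
  obtain ⟨K, hK0, hK⟩ := exists_heatEvol_norm_rpow_le hN hγ0 hγN
  obtain ⟨C₀, hC₀, hC⟩ := exists_heatEvol_le_ulNorm N
  have hv := hf.negPowF_pos (r := r) hξ
  -- The time exponent has the sign of r - N/(2-γ).
  have hκ : 1 - γ / 2 - N / (2 * r) = (r - N / (2 - γ)) * ((2 - γ) / (2 * r)) := by
    field_simp
  have key : (N : ℝ) / 2 * (1 / r - δ) + γ / 2 < 1 ∧ ∃ E T : ℝ, 0 < E ∧ 0 < T ∧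
      (∀ t ∈ Ioo 0 T, ∀ x, 2 * heatEvol t (fun y => negPowF f r ξ + negPowF f r (w y)) x ≤
        ENNReal.ofReal (E * t ^ (-(N : ℝ) / 2))) ∧
      (∀ t ∈ Ioo 0 T, E ^ (1 / r) * (2 * K) *
        (2 / (1 - ((N : ℝ) / 2 * (1 / r - δ) + γ / 2)) + 2 / (1 - γ / 2)) *
          t ^ (1 - γ / 2 - N / (2 * r)) ≤ 1 / (2 * r)) := by
    have hsplit : (N : ℝ) / 2 * (1 / r - δ) + γ / 2 =
        1 - (1 - γ / 2 - N / (2 * r)) - N / 2 * δ := by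
      field_simp
      ring
    rcases lt_or_eq_of_le (show (N : ℝ) / (2 - γ) ≤ r by
      rcases h with h | h | h
      exacts [h.1.le, h.1.le, h.1.ge]) with hlt | heq
    · have hκ0 : 0 < 1 - γ / 2 - N / (2 * r) := by
        rw [hκ]
        exact mul_pos (sub_pos.2 hlt) (by positivity)
      have hNδ : 0 ≤ (N : ℝ) / 2 * δ := by positivity
      refine ⟨by linarith, ?_⟩
      obtain ⟨E, hE, hEb⟩ := exists_bound_of_ulNorm_lt_top hC₀ hC hφm
        (fun x => negPowF_nonneg _ _ _) hulw hv
      obtain ⟨T, hT, hT1, hTs⟩ := exists_time_subcritical (c := E ^ (1 / r) * (2 * K) *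
        (2 / (1 - ((N : ℝ) / 2 * (1 / r - δ) + γ / 2)) + 2 / (1 - γ / 2))) hκ0
        (show 0 < 1 / (2 * r) by positivity)
      exact ⟨E, T, hE, hT, fun t ht x => hEb t ht.1 (ht.2.le.trans hT1) x, hTs⟩
    · have hκ0 : 1 - γ / 2 - N / (2 * r) = 0 := by rw [hκ, heq, sub_self, zero_mul]
      obtain ⟨hq', hcl⟩ : q < 1 + r ∧ MemULClosure (fun x => negPowF f r (u₀ x)) := by
        rcases h with h | h | h
        exacts [absurd heq h.1.ne, absurd heq h.1.ne, h.2]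
      have hNδ : 0 < (N : ℝ) / 2 * δ := mul_pos (by linarith) (hδpos hq')
      refine ⟨by linarith, ?_⟩
      -- With time exponent 0, smallness must come from E^{1/r}. The lemma is applied with E in the
      -- role of time, and E/2 lies in its open interval.
      obtain ⟨E, hE, -, hEs⟩ := exists_time_subcritical (c := (2 * K) *
        (2 / (1 - ((N : ℝ) / 2 * (1 / r - δ) + γ / 2)) + 2 / (1 - γ / 2)))
        (show 0 < 1 / r by positivity) (show 0 < 1 / (2 * r) by positivity)
      have hEs' := hEs (E / 2) ⟨half_pos hE, half_lt_self hE⟩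
      obtain ⟨T, hT, -, hTb⟩ := exists_bound_of_approx hN hC₀ hC hφm
        (fun x => negPowF_nonneg _ _ _) (fun ε hε => by
          obtain ⟨g, hg, hM, hgε⟩ := hcl.2 ε hε
          refine ⟨g, hg, hM, lt_of_eq_of_lt (ulNorm_congr_ae ?_) hgε⟩
          exact hφe.symm.mono fun x hx => by simp only [hx]) hv (half_pos hE)
      refine ⟨E / 2, T, half_pos hE, hT, hTb, fun t _ => ?_⟩
      rw [hκ0, Real.rpow_zero, mul_one]
      refine le_trans (le_of_eq ?_) hEs'
      ring
  obtain ⟨ha, E, T, hE, hT, hbound, hsmall⟩ := key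
  obtain ⟨u, hu, hub⟩ := hf.exists_solution_of_heatEvol_bound hr hξ hδ0 hδ hup hlow hγ0 hK0 hK ha
    hw0 hwm hulw hE hbound hsmall
  refine ⟨T, hT, u, ⟨hu.measurable, hu.nonneg, hu.bounded_ul, hu.locally_bounded, ?_⟩, ?_⟩
  · intro t ht
    filter_upwards [hu.duhamel t ht] with x hx
    rw [hx, heatEvol_congr_ae hwe]
  · intro t ht
    refine ⟨(hub t ht).1, (hub t ht).2.trans ?_⟩
    rw [← ulNorm_congr_ae hφe, ← hB, ENNReal.coe_add, ENNReal.coe_toNNReal hBt.ne]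
    exact le_self_add
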